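/- Let $W$ be a smooth, compact, path-connected (Hausdorff) manifold with non-empty boundary, of dimension $d\ge 3$, and let $\pi\colon E\to W$ be a (locally trivial) fibre bundle with path-connected fibre $F$. For $k\ge 0$ let $$\widetilde C_k(W;\pi)=\{(\mathbf w,\mathbf x)\in (W\setminus\partial W)^k\times E^k : \pi(x_i)=w_i \text{ for all } i,\ w_i\ne w_j\text{ for } i\neq j\}$$ with the subspace topology, and let $C_k(W;\pi)=\widetilde C_k(W;\pi)/\Sigma_k$ be its orbit space under the action of the symmetric group $\Sigma_k$ that permutes the $k$ labelled points (the unordered configuration space with twisted labels in $\pi$). Then, for all base points $e\in E$ and $c\in C_k(W;\pi)$, there is an isomorphism of groups $$\pi_1(C_k(W;\pi),c)\;\cong\;\Sigma_k\wr\pi_1(E,e),$$ where $\Sigma_k\wr G=G^k\rtimes\Sigma_k$ denotes the wreath product, in which $\Sigma_k$ acts on $G^k$ by permuting the factors. -/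

import Mathlib

open scoped Manifold ContDiff

/-- `π : E → B` is a (locally trivial) fibre bundle with fibre `F`: every point of `B` lies in an
open set over which `π` is isomorphic to the projection of a product with `F`. -/
def IsFibreBundle (F : Type*) [TopologicalSpace F] {E B : Type*} [TopologicalSpace E]
    [TopologicalSpace B] (π : E → B) : Prop :=
  ∀ b : B, ∃ t : Bundle.Trivialization F π, b ∈ t.baseSet

section Configurations

variable {d : ℕ} [NeZero d] {W E : Type*} [TopologicalSpace W]
  [ChartedSpace (EuclideanHalfSpace d) W] [TopologicalSpace E]

/-- The ordered configuration space of `k` particles in the interior of the `d`-dimensional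
manifold with boundary `W`, with twisted labels in `π : E → W`: pairs `(w, x)` of a `k`-tuple of
interior points of `W` and a `k`-tuple of points of `E` such that `π (x i) = w i` for all `i`, and
`w i ≠ w j` for `i ≠ j`. It carries the subspace topology. -/
def OrderedConfig (d : ℕ) [NeZero d] {W E : Type*} [TopologicalSpace W]
    [ChartedSpace (EuclideanHalfSpace d) W] (π : E → W) (k : ℕ) : Type _ :=
  {p : (Fin k → (𝓡∂ d).interior W) × (Fin k → E) //
    (∀ i, π (p.2 i) = (p.1 i : W)) ∧ ∀ i j, i ≠ j → p.1 i ≠ p.1 j}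

instance OrderedConfig.instTopologicalSpace (π : E → W) (k : ℕ) :
    TopologicalSpace (OrderedConfig d π k) :=
  inferInstanceAs (TopologicalSpace (Subtype _))

/-- The symmetric group permutes the particles together with their labels. -/
instance OrderedConfig.instMulAction (π : E → W) (k : ℕ) :
    MulAction (Equiv.Perm (Fin k)) (OrderedConfig d π k) where
  smul σ p := ⟨(fun i => p.1.1 (σ⁻¹ i), fun i => p.1.2 (σ⁻¹ i)),
    fun i => p.2.1 (σ⁻¹ i), fun _ _ h => p.2.2 _ _ fun h' => h (σ⁻¹.injective h')⟩
  one_smul _ := rfl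
  mul_smul _ _ _ := rfl

/-- The configuration space of `k` unordered particles with twisted labels in `π`: the
orbit space of the action of the symmetric group, with the quotient topology. -/
def UnorderedConfig (d : ℕ) [NeZero d] {W E : Type*} [TopologicalSpace W]
    [ChartedSpace (EuclideanHalfSpace d) W] (π : E → W) (k : ℕ) : Type _ :=
  Quotient (MulAction.orbitRel (Equiv.Perm (Fin k)) (OrderedConfig d π k))

instance UnorderedConfig.instTopologicalSpace (π : E → W) (k : ℕ) :
    TopologicalSpace (UnorderedConfig d π k) :=
  inferInstanceAs (TopologicalSpace (Quotient _))

end Configurations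

/-- The wreath product `Σ_k ≀ G`: the semidirect product of `G ^ k` and the symmetric group
`Σ_k`, which acts on `G ^ k` by permuting the factors, `(σ • g) i = g (σ⁻¹ i)`. -/
abbrev SymmetricWreathProduct (k : ℕ) (G : Type*) [Group G] : Type _ :=
  (Fin k → G) ⋊[(mulAutArrow : Equiv.Perm (Fin k) →* MulAut (Fin k → G))] Equiv.Perm (Fin k)

/-! Labels determine a configuration, so the ordered configurations form the subspace of `E^k` lying
over the tuples of distinct interior points in `W^k`. Collisions have codimension `d ≥ 3` and
boundary points can be pushed inwards, so removing both should not change homotopy classes of paths.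
Instead of transversality, the argument is local. Every point of `W^k` has arbitrarily small simply
connected boxes whose admissible part is again simply connected, being in charts an open convex set
minus linear subspaces of codimension `d` (`exists_isSimplyConnected_box`). Local trivializations
carry this to `E^k` (`Path.relSimplyConnected_preimage`), and a subdivision argument in the style of
Seifert–van Kampen makes it global (`Path.isRelFull_preimage`, `Path.homotopicIn_square`). Hence
paths of ordered configurations and paths in `E^k` with the same ends have the same homotopy classes
(`OrderedConfig.map_labels_bijective`).

The orbit map is a covering with group `Σ_k`, so a loop at the orbit of `z` lifts to a path from `σ
• z` to `z` for a unique `σ`. Up to homotopy such a path is a family of `k` paths in `E`, from label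
`σ⁻¹ i` to label `i`. As `E` is path-connected, fixed paths to `e` turn these into `k` arbitrary
elements of `π₁(E, e)`. Concatenation multiplies them with a twist by `σ`, which is the wreath
product law (`nonempty_fundamentalGroup_mulEquiv_wreath`). -/

section RelativeFundamentalGroupoid

open scoped unitInterval
open CategoryTheory

/-! ### Paths and homotopies confined to a subset -/

namespace Path

variable {X Y : Type*} [TopologicalSpace X] [TopologicalSpace Y] {x y z : X} {S T : Set X}

/-- Two paths are homotopic in `S` if there is a homotopy of paths between them that stays
in `S`. -/
def HomotopicIn (S : Set X) (γ γ' : Path x y) : Prop :=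
  ∃ F : γ.Homotopy γ', ∀ s, F s ∈ S

theorem HomotopicIn.mono {γ γ' : Path x y} (h : HomotopicIn S γ γ') (hST : S ⊆ T) :
    HomotopicIn T γ γ' :=
  h.imp fun _ hF s => hST (hF s)

theorem HomotopicIn.map {γ γ' : Path x y} (h : HomotopicIn S γ γ') {f : X → Y} (hf : Continuous f)
    {T : Set Y} (hST : Set.MapsTo f S T) : HomotopicIn T (γ.map hf) (γ'.map hf) := by
  obtain ⟨F, hF⟩ := h
  exact ⟨F.map ⟨f, hf⟩, fun s => hST (hF s)⟩

theorem HomotopicIn.homotopic {γ γ' : Path x y} (h : HomotopicIn S γ γ') : γ.Homotopic γ' :=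
  ⟨h.choose⟩

theorem forall_trans_mem_iff {γ : Path x y} {γ' : Path y z} :
    (∀ t, (γ.trans γ') t ∈ S) ↔ (∀ t, γ t ∈ S) ∧ ∀ t, γ' t ∈ S := by
  simp only [← Set.range_subset_iff, Path.trans_range, Set.union_subset_iff]

theorem forall_symm_mem_iff {γ : Path x y} : (∀ t, γ.symm t ∈ S) ↔ ∀ t, γ t ∈ S := by
  simp only [← Set.range_subset_iff, Path.symm_range]

/-- A path that stays in `S`, as a path of the subspace `S`. -/
def codRestrict (S : Set X) (γ : Path x y) (h : ∀ t, γ t ∈ S) :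
    Path (⟨x, by simpa using h 0⟩ : S) ⟨y, by simpa using h 1⟩ where
  toFun t := ⟨γ t, h t⟩
  source' := by simp
  target' := by simp

theorem codRestrict_homotopic_iff {γ γ' : Path x y} (h : ∀ t, γ t ∈ S) (h' : ∀ t, γ' t ∈ S) :
    (γ.codRestrict S h).Homotopic (γ'.codRestrict S h') ↔ HomotopicIn S γ γ' := by
  constructor
  · rintro ⟨F⟩
    exact ⟨F.map ⟨Subtype.val, continuous_subtype_val⟩, fun s => (F s).2⟩
  · rintro ⟨F, hF⟩
    exact ⟨{
      toFun s := ⟨F s, hF s⟩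
      map_zero_left t := Subtype.ext (F.map_zero_left t)
      map_one_left t := Subtype.ext (F.map_one_left t)
      prop' s t ht := Subtype.ext (F.prop' s t ht) }⟩

/-- The class of a path that stays in `S`, as a morphism of the fundamental groupoid of `S`. -/
def homIn (S : Set X) (γ : Path x y) (h : ∀ t, γ t ∈ S) :
    FundamentalGroupoid.mk (⟨x, by simpa using h 0⟩ : S) ⟶
      FundamentalGroupoid.mk (⟨y, by simpa using h 1⟩ : S) :=
  Homotopic.Quotient.mk (γ.codRestrict S h)

theorem homIn_eq_iff {γ γ' : Path x y} {h : ∀ t, γ t ∈ S} {h' : ∀ t, γ' t ∈ S} :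
    homIn S γ h = homIn S γ' h' ↔ HomotopicIn S γ γ' :=
  Homotopic.Quotient.eq.trans (codRestrict_homotopic_iff h h')

theorem homIn_trans {γ : Path x y} {γ' : Path y z} (h : ∀ t, (γ.trans γ') t ∈ S) :
    homIn S (γ.trans γ') h =
      homIn S γ (forall_trans_mem_iff.1 h).1 ≫ homIn S γ' (forall_trans_mem_iff.1 h).2 := by
  refine congrArg Homotopic.Quotient.mk (?_ : _ = (codRestrict S γ _).trans (codRestrict S γ' _))
  ext t
  change (γ.trans γ') t = _
  simp only [Path.trans_apply]
  split_ifs <;> rfl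

theorem homotopicIn_trans_iff {y' : X} {a : Path x y} {b : Path y z} {c : Path x y'}
    {d : Path y' z} (ha : ∀ t, a t ∈ S) (hb : ∀ t, b t ∈ S) (hc : ∀ t, c t ∈ S)
    (hd : ∀ t, d t ∈ S) :
    homIn S a ha ≫ homIn S b hb = homIn S c hc ≫ homIn S d hd ↔
      HomotopicIn S (a.trans b) (c.trans d) := by
  rw [← homIn_eq_iff (h := forall_trans_mem_iff.2 ⟨ha, hb⟩) (h' := forall_trans_mem_iff.2 ⟨hc, hd⟩),
    homIn_trans, homIn_trans]

theorem homIn_refl (h : ∀ t, Path.refl x t ∈ S) : homIn S (Path.refl x) h = 𝟙 _ := rfl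

theorem homIn_symm {γ : Path x y} (h : ∀ t, γ.symm t ∈ S) :
    homIn S γ.symm h = Groupoid.inv (homIn S γ (forall_symm_mem_iff.1 h)) :=
  rfl

theorem _root_.Convex.homotopicIn {V : Type*} [AddCommGroup V] [TopologicalSpace V]
    [IsTopologicalAddGroup V] [Module ℝ V] [ContinuousSMul ℝ V] {C : Set V} (hC : Convex ℝ C)
    {a b : V} {γ γ' : Path a b} (h : ∀ t, γ t ∈ C) (h' : ∀ t, γ' t ∈ C) : HomotopicIn C γ γ' :=
  ⟨{ toFun s := AffineMap.lineMap (γ s.2) (γ' s.2) (s.1 : ℝ)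
     continuous_toFun := by simp only [AffineMap.lineMap_apply]; fun_prop
     map_zero_left := by simp
     map_one_left := by simp
     prop' s t ht := by rcases ht with rfl | rfl <;> simp },
   fun s => hC.lineMap_mem (h _) (h' _) s.1.2⟩

/-- The image of the straight path from `a` to `b` under a continuous map. -/
def segmentMap {V : Type*} [AddCommGroup V] [TopologicalSpace V]
    [IsTopologicalAddGroup V] [Module ℝ V] [ContinuousSMul ℝ V] (f : C(V, X)) (a b : V) :
    Path (f a) (f b) :=
  (Path.segment a b).map f.continuous

section segmentMap

variable {V : Type*} [AddCommGroup V] [TopologicalSpace V]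
    [IsTopologicalAddGroup V] [Module ℝ V] [ContinuousSMul ℝ V] {f : C(V, X)} {a b c : V}
    {C : Set V}

theorem segmentMap_mem (hC : Convex ℝ C) (hCS : Set.MapsTo f C S) (ha : a ∈ C) (hb : b ∈ C)
    (t : I) : segmentMap f a b t ∈ S :=
  hCS (hC.lineMap_mem ha hb t.2)

theorem homIn_segmentMap_self (h : ∀ t, segmentMap f a a t ∈ S) :
    homIn S (segmentMap f a a) h = 𝟙 _ := by
  have : segmentMap f a a = Path.refl (f a) := by
    ext
    simp [segmentMap]
  rw [← homIn_refl (fun t => by simpa using h 0), homIn_eq_iff, this]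
  exact ⟨Homotopy.refl _, fun t => by simpa using h 0⟩

theorem homIn_segmentMap_comp (hC : Convex ℝ C) (hCS : Set.MapsTo f C S) (ha : a ∈ C) (hb : b ∈ C)
    (hc : c ∈ C) : homIn S (segmentMap f a b) (segmentMap_mem hC hCS ha hb) ≫
      homIn S (segmentMap f b c) (segmentMap_mem hC hCS hb hc) =
      homIn S (segmentMap f a c) (segmentMap_mem hC hCS ha hc) := by
  have h : ∀ t, ((Path.segment a b).trans (Path.segment b c)) t ∈ C :=
    forall_trans_mem_iff.2 ⟨fun t => hC.lineMap_mem ha hb t.2, fun t => hC.lineMap_mem hb hc t.2⟩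
  have key := (hC.homotopicIn h (γ' := Path.segment a c)
    fun t => hC.lineMap_mem ha hc t.2).map f.continuous hCS
  rw [← homIn_trans (forall_trans_mem_iff.2 ⟨segmentMap_mem hC hCS ha hb,
    segmentMap_mem hC hCS hb hc⟩), homIn_eq_iff]
  rwa [Path.map_trans] at key

end segmentMap

/-- Every path in `V` whose ends lie in `A` can be deformed in `V` into `A`. -/
def IsRelFull (A V : Set X) : Prop :=
  ∀ ⦃x y : X⦄ (γ : Path x y), x ∈ A → y ∈ A → (∀ t, γ t ∈ V) →
    ∃ γ' : Path x y, (∀ t, γ' t ∈ A) ∧ HomotopicIn V γ' γ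

/-- The pair `(V, A ∩ V)` is 2-connected relative to `A`: every point of `V` is joined in `V` to a
point of `A`, every path in `V` between points of `A` can be deformed in `V` into `A`, and two paths
in `A ∩ V` that are homotopic in `V` are homotopic in `A`. -/
structure RelSimplyConnected (A V : Set X) : Prop where
  exists_path : ∀ x ∈ V, ∃ a ∈ A, ∃ γ : Path a x, ∀ t, γ t ∈ V
  isRelFull : IsRelFull A V
  homotopicIn : ∀ {x y : X} {γ γ' : Path x y}, (∀ t, γ t ∈ A) → (∀ t, γ' t ∈ A) →
    HomotopicIn V γ γ' → HomotopicIn A γ γ'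

theorem HomotopicIn.mem_left {γ γ' : Path x y} (h : HomotopicIn S γ γ') (t : I) : γ t ∈ S := by
  obtain ⟨F, hF⟩ := h
  simpa using hF (0, t)

theorem HomotopicIn.mem_right {γ γ' : Path x y} (h : HomotopicIn S γ γ') (t : I) : γ' t ∈ S := by
  obtain ⟨F, hF⟩ := h
  simpa using hF (1, t)

/-- Deform `α`, then `γ`, then `β` reversed into `A`. The commuting square form lets consecutive
edges be pasted along their connecting paths. -/
theorem IsRelFull.exists_comp_eq {A V : Set X} (hV : IsRelFull A V) {u v : X} {α : Path u x}
    {γ : Path x y} {β : Path v y} (hu : u ∈ A) (hv : v ∈ A) (hα : ∀ t, α t ∈ V)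
    (hγ : ∀ t, γ t ∈ V) (hβ : ∀ t, β t ∈ V) :
    ∃ ρ : Path u v, (∀ t, ρ t ∈ A) ∧ HomotopicIn V (ρ.trans β) (α.trans γ) := by
  obtain ⟨ρ, hρA, hρ⟩ := hV ((α.trans γ).trans β.symm) hu hv
    (forall_trans_mem_iff.2 ⟨forall_trans_mem_iff.2 ⟨hα, hγ⟩, forall_symm_mem_iff.2 hβ⟩)
  refine ⟨ρ, hρA, ?_⟩
  have hρ' := (homIn_eq_iff (h := hρ.mem_left) (h' := hρ.mem_right)).2 hρ
  rw [← homotopicIn_trans_iff hρ.mem_left hβ hα hγ, hρ', homIn_trans, homIn_trans, homIn_symm]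
  simp

theorem HomotopicIn.cast {γ γ' : Path x y} (h : HomotopicIn S γ γ') {x' y' : X} (hx : x' = x)
    (hy : y' = y) : HomotopicIn S (γ.cast hx hy) (γ'.cast hx hy) := by
  subst hx hy
  exact h

end Path

theorem CategoryTheory.exists_grid_comp {C : Type*} [Category C] {u : ℕ → ℕ → C}
    (g : ∀ n m, u n m ⟶ u n (m + 1)) (w : ∀ n m, u n m ⟶ u (n + 1) m)
    (sq : ∀ n m, g n m ≫ w n (m + 1) = w n m ≫ g (n + 1) m) :
    ∃ (G : ∀ n m, u n 0 ⟶ u n m) (W : ∀ n m, u 0 m ⟶ u n m),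
      (∀ n, G n 0 = 𝟙 _) ∧ (∀ n m, G n (m + 1) = G n m ≫ g n m) ∧
      (∀ m, W 0 m = 𝟙 _) ∧ (∀ n m, W (n + 1) m = W n m ≫ w n m) ∧
      ∀ n m, G 0 m ≫ W n m = W n 0 ≫ G n m := by
  let G : ∀ n m, u n 0 ⟶ u n m := fun n m => Nat.rec (𝟙 _) (fun m h => h ≫ g n m) m
  let W : ∀ n m, u 0 m ⟶ u n m := fun n m => Nat.rec (𝟙 _) (fun n h => h ≫ w n m) n
  have hG : ∀ n m, G n (m + 1) = G n m ≫ g n m := fun _ _ => rfl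
  have hW : ∀ n m, W (n + 1) m = W n m ≫ w n m := fun _ _ => rfl
  have hGw : ∀ n m, G n m ≫ w n m = w n 0 ≫ G (n + 1) m := by
    intro n m
    induction m with
    | zero => simp [G]
    | succ m ih => rw [hG, hG, Category.assoc, sq, ← Category.assoc, ih, Category.assoc]
  refine ⟨G, W, fun _ => rfl, hG, fun _ => rfl, hW, fun n m => ?_⟩
  induction n with
  | zero => simp [W]
  | succ n ih => rw [hW, hW, ← Category.assoc, ih, Category.assoc, hGw, Category.assoc]

/-! ### From local to global: deforming paths -/

namespace Path

variable {X Y : Type*} [TopologicalSpace X] [TopologicalSpace Y] {A : Set X} {p : X → Y}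

/-- Subdivide the path into pieces lying in good sets and deform piece by piece. The result holds
for every open `N`, whereas an intersection of good sets need not be good; edges of a grid will lie
in such intersections. -/
theorem isRelFull_preimage (hp : Continuous p)
    (hloc : ∀ N : Set Y, IsOpen N → ∀ y ∈ N, ∃ B : Set Y, IsOpen B ∧ y ∈ B ∧ B ⊆ N ∧
      RelSimplyConnected A (p ⁻¹' B)) {N : Set Y} (hN : IsOpen N) : IsRelFull A (p ⁻¹' N) := by
  intro x y γ hx hy hγ
  choose B hBo hyB hBN hB using fun y : N => hloc N hN y y.2
  let f : C(ℝ, X) := ⟨γ.extend, γ.continuous_extend⟩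
  have hf : ∀ s, f s ∈ p ⁻¹' N := fun s => hγ (Set.projIcc 0 1 zero_le_one s)
  have hfN : Set.MapsTo f Set.univ (p ⁻¹' N) := fun s _ => hf s
  obtain ⟨t, ht0, htm, ⟨n₁, hn₁⟩, ht⟩ := exists_monotone_Icc_subset_open_cover_unitInterval
    (c := fun i : N => (fun s : I => p (γ s)) ⁻¹' B i)
    (fun i => (hBo i).preimage (hp.comp γ.continuous))
    (fun s _ => Set.mem_iUnion.2 ⟨⟨p (γ s), hγ s⟩, hyB _⟩)
  choose i hi using ht
  have hfi : ∀ n, Set.MapsTo f (Set.Icc (t n : ℝ) (t (n + 1))) (p ⁻¹' B (i n)) := by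
    intro n s hs
    have hs' : s ∈ I := ⟨(t n).2.1.trans hs.1, hs.2.trans (t (n + 1)).2.2⟩
    have : f s = γ ⟨s, hs'⟩ := γ.extend_apply hs'
    rw [Set.mem_preimage, this]
    exact hi n (show (⟨s, hs'⟩ : I) ∈ _ from hs)
  have hle : ∀ n, (t n : ℝ) ≤ t (n + 1) := fun n => htm n.le_succ
  have hf0 : f 0 = x := γ.extend_zero
  have hf1 : f 1 = y := γ.extend_one
  -- The connecting path `α` must fit into an arbitrary neighbourhood `M` of the current point,
  -- because the next step needs it inside the next good set.
  have key : ∀ n (M : Set Y), IsOpen M → p (f (t n)) ∈ M →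
      ∃ u ∈ A, ∃ (α : Path u (f (t n))) (δ : Path (f 0) u), (∀ s, α s ∈ p ⁻¹' M) ∧
        (∀ s, δ s ∈ A) ∧ HomotopicIn (p ⁻¹' N) (δ.trans α) (segmentMap f 0 (t n)) := by
    intro n
    induction n with
    | zero =>
      intro M _ hM
      have h0 : (t 0 : ℝ) = 0 := by simp [ht0]
      rw [h0] at hM ⊢
      refine ⟨f 0, hf0 ▸ hx, Path.refl _, Path.refl _, fun _ => hM, fun _ => hf0 ▸ hx, ?_⟩
      have h1 := (convex_univ (𝕜 := ℝ) (E := ℝ)).homotopicIn (γ := (Path.refl 0).trans (Path.refl 0))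
        (γ' := Path.segment 0 0) (fun _ => trivial) (fun _ => trivial)
      have h2 := h1.map f.continuous hfN
      rwa [Path.map_trans] at h2
    | succ n ih =>
      intro M hM hMn
      obtain ⟨u, hu, α, δ, hα, hδ, hδα⟩ := ih (B (i n)) (hBo _) (hfi n ⟨le_rfl, hle n⟩)
      -- The new connecting path has to lie in `M` for the conclusion and in `B (i n)` for fullness
      -- to apply to the current piece.
      obtain ⟨B', hB'o, hB'n, hB'M, hB'⟩ := hloc (M ∩ B (i n)) (hM.inter (hBo _)) (p (f (t (n + 1))))
        ⟨hMn, hfi n ⟨hle n, le_rfl⟩⟩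
      obtain ⟨v, hv, β, hβ⟩ := hB'.exists_path _ hB'n
      have hβ' : ∀ s, β s ∈ p ⁻¹' B (i n) := fun s => (hB'M (hβ s)).2
      have hc := segmentMap_mem (convex_Icc (t n : ℝ) (t (n + 1))) (hfi n) ⟨le_rfl, hle n⟩
        ⟨hle n, le_rfl⟩
      obtain ⟨ρ, hρA, hρ⟩ := (hB (i n)).isRelFull.exists_comp_eq hu hv hα hc hβ'
      have hρ2 := hρ.mono (Set.preimage_mono (hBN (i n)))
      have hρ1 := forall_trans_mem_iff.1 hρ2.mem_left
      have hα1 := forall_trans_mem_iff.1 hρ2.mem_right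
      have hδ1 := forall_trans_mem_iff.1 hδα.mem_left
      refine ⟨v, hv, β, δ.trans ρ, fun s => (hB'M (hβ s)).1, forall_trans_mem_iff.2 ⟨hδ, hρA⟩, ?_⟩
      rw [← homIn_eq_iff (h := forall_trans_mem_iff.2 ⟨forall_trans_mem_iff.2 ⟨hδ1.1, hρ1.1⟩, hρ1.2⟩)
        (h' := segmentMap_mem convex_univ hfN trivial trivial), homIn_trans, homIn_trans,
        Category.assoc, (homotopicIn_trans_iff hρ1.1 hρ1.2 hα1.1 hα1.2).2 hρ2, ← Category.assoc,
        ← homIn_trans (forall_trans_mem_iff.2 hδ1),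
        (homIn_eq_iff (h' := segmentMap_mem convex_univ hfN trivial trivial)).2 hδα,
        homIn_segmentMap_comp convex_univ hfN trivial trivial trivial]
  obtain ⟨B', hB'o, hB'1, hB'N, hB'⟩ := hloc N hN (p (f 1)) (hf 1)
  have h1 := key n₁ B' hB'o
  rw [show (t n₁ : ℝ) = 1 by simp [hn₁ n₁ le_rfl]] at h1
  obtain ⟨u, hu, α, δ, hα, hδ, hδα⟩ := h1 hB'1
  obtain ⟨α', hα'A, hα'⟩ := hB'.isRelFull α hu (hf1 ▸ hy) hα
  have hα'2 := hα'.mono (Set.preimage_mono hB'N)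
  have hδ1 := forall_trans_mem_iff.1 hδα.mem_left
  have hfin : HomotopicIn (p ⁻¹' N) (δ.trans α') (segmentMap f 0 1) := by
    rw [← homIn_eq_iff (h := forall_trans_mem_iff.2 ⟨hδ1.1, hα'2.mem_left⟩)
        (h' := segmentMap_mem convex_univ hfN trivial trivial), homIn_trans,
        (homIn_eq_iff (h' := hα'2.mem_right)).2 hα'2, ← homIn_trans (forall_trans_mem_iff.2 hδ1),
        homIn_eq_iff.2 hδα]
  refine ⟨(δ.trans α').cast hf0.symm hf1.symm, fun s => forall_trans_mem_iff.2 ⟨hδ, hα'A⟩ s, ?_⟩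
  convert hfin.cast hf0.symm hf1.symm
  ext s
  change γ s = γ.extend (AffineMap.lineMap (0 : ℝ) 1 (s : ℝ))
  rw [show AffineMap.lineMap (0 : ℝ) 1 (s : ℝ) = (s : ℝ) by simp [AffineMap.lineMap_apply],
    γ.extend_apply s.2]

end Path

/-! ### From local to global: deforming homotopies -/

namespace Path

variable {X Y : Type*} [TopologicalSpace X] [TopologicalSpace Y] {A : Set X} {p : X → Y}

/-- A square whose sides lie in `A` commutes in the fundamental groupoid of `A`. -/
theorem homotopicIn_square (hp : Continuous p)
    (hloc : ∀ N : Set Y, IsOpen N → ∀ y ∈ N, ∃ B : Set Y, IsOpen B ∧ y ∈ B ∧ B ⊆ N ∧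
      RelSimplyConnected A (p ⁻¹' B)) (F : C(I × I, X)) (f : C(ℝ × ℝ, X))
    (hf : ∀ s, f s = F (Set.projIcc 0 1 zero_le_one s.1, Set.projIcc 0 1 zero_le_one s.2))
    (hl : ∀ s, f (s, 0) ∈ A) (hr : ∀ s, f (s, 1) ∈ A) (hb : ∀ s, f (0, s) ∈ A)
    (ht : ∀ s, f (1, s) ∈ A) :
    HomotopicIn A ((segmentMap f (0, 0) (0, 1)).trans (segmentMap f (0, 1) (1, 1)))
      ((segmentMap f (0, 0) (1, 0)).trans (segmentMap f (1, 0) (1, 1))) := by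
  choose B hBo hyB _ hB using fun y : Y => hloc Set.univ isOpen_univ y trivial
  obtain ⟨t, ht0, htm, ⟨N, hN⟩, hi⟩ := exists_monotone_Icc_subset_open_cover_unitInterval_prod_self
    (c := fun i : Y => (fun s : I × I => p (F s)) ⁻¹' B i)
    (fun i => (hBo i).preimage (hp.comp F.continuous))
    (fun s _ => Set.mem_iUnion.2 ⟨p (F s), hyB _⟩)
  choose i hi using hi
  let r : ℕ → ℝ := fun n => t n
  have hr0 : r 0 = 0 := by simp [r, ht0]
  have hrN : r N = 1 := by simp [r, hN N le_rfl]
  let R : ℕ → ℕ → Set (ℝ × ℝ) := fun n m => Set.Icc (r n) (r (n + 1)) ×ˢ Set.Icc (r m) (r (m + 1))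
  have hRc : ∀ n m, Convex ℝ (R n m) := fun n m => (convex_Icc _ _).prod (convex_Icc _ _)
  have hfi : ∀ n m, Set.MapsTo f (R n m) (p ⁻¹' B (i n m)) := by
    rintro n m ⟨a, b⟩ ⟨ha, hb⟩
    have ha' : a ∈ I := ⟨(t n).2.1.trans ha.1, ha.2.trans (t (n + 1)).2.2⟩
    have hb' : b ∈ I := ⟨(t m).2.1.trans hb.1, hb.2.trans (t (m + 1)).2.2⟩
    rw [Set.mem_preimage, hf, Set.projIcc_of_mem _ ha', Set.projIcc_of_mem _ hb']
    exact hi n m (show ((⟨a, ha'⟩, ⟨b, hb'⟩) : I × I) ∈ _ from ⟨ha, hb⟩)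
  have hle : ∀ n, r n ≤ r (n + 1) := fun n => htm n.le_succ
  have hI : ∀ n, r n ∈ Set.Icc (r n) (r (n + 1)) := fun n => ⟨le_rfl, hle n⟩
  have hI1 : ∀ n, r (n + 1) ∈ Set.Icc (r n) (r (n + 1)) := fun n => ⟨hle n, le_rfl⟩
  -- Truncated subtraction gives `n - 1 = 0` at `n = 0`, so on the first row or column the condition
  -- from the missing neighbour repeats an existing one.
  have hI' : ∀ n, r n ∈ Set.Icc (r (n - 1)) (r (n - 1 + 1)) := by
    rintro (_ | n)
    exacts [hI 0, hI1 n]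
  -- Each vertex is joined to `A` inside all four adjacent cells. A vertex already in `A` keeps a
  -- constant path, so that the boundary can be compared within `A`.
  have hvert : ∀ n m, ∃ u ∈ A, ∃ α : Path u (f (r n, r m)),
      (f (r n, r m) ∈ A → ∀ s, α s ∈ A) ∧ ∀ s, α s ∈ p ⁻¹' (B (i n m) ∩ B (i (n - 1) m) ∩
        (B (i n (m - 1)) ∩ B (i (n - 1) (m - 1)))) := by
    intro n m
    obtain ⟨B', -, hB'n, hB's, hB'⟩ := hloc (B (i n m) ∩ B (i (n - 1) m) ∩
        (B (i n (m - 1)) ∩ B (i (n - 1) (m - 1))))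
      (((hBo _).inter (hBo _)).inter ((hBo _).inter (hBo _))) (p (f (r n, r m)))
      ⟨⟨hfi n m ⟨hI _, hI _⟩, hfi (n - 1) m ⟨hI' _, hI _⟩⟩,
        hfi n (m - 1) ⟨hI _, hI' _⟩, hfi (n - 1) (m - 1) ⟨hI' _, hI' _⟩⟩
    by_cases h : f (r n, r m) ∈ A
    · exact ⟨_, h, Path.refl _, fun _ _ => h, fun s => hB's hB'n⟩
    · obtain ⟨u, hu, α, hα⟩ := hB'.exists_path _ hB'n
      exact ⟨u, hu, α, fun h' => (h h').elim, fun s => hB's (hα s)⟩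
  choose u hu α hαA hα using hvert
  -- An edge is pushed into `A` inside the intersection of its two cells, so the same pushed edge
  -- serves both.
  have hedge : ∀ n m, ∃ ρ : Path (u n m) (u n (m + 1)), (∀ s, ρ s ∈ A) ∧
      HomotopicIn (p ⁻¹' (B (i n m) ∩ B (i (n - 1) m))) (ρ.trans (α n (m + 1)))
        ((α n m).trans (segmentMap f (r n, r m) (r n, r (m + 1)))) := by
    intro n m
    refine (isRelFull_preimage hp hloc ((hBo _).inter (hBo _))).exists_comp_eq (hu _ _) (hu _ _)
      (fun s => (hα n m s).1) (fun s => ⟨?_, ?_⟩) fun s => (hα n (m + 1) s).2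
    · exact segmentMap_mem (hRc n m) (hfi n m) ⟨hI _, hI _⟩ ⟨hI _, hI1 _⟩ s
    · exact segmentMap_mem (hRc (n - 1) m) (hfi (n - 1) m) ⟨hI' _, hI _⟩ ⟨hI' _, hI1 _⟩ s
  have hedge' : ∀ n m, ∃ ρ : Path (u n m) (u (n + 1) m), (∀ s, ρ s ∈ A) ∧
      HomotopicIn (p ⁻¹' (B (i n m) ∩ B (i n (m - 1)))) (ρ.trans (α (n + 1) m))
        ((α n m).trans (segmentMap f (r n, r m) (r (n + 1), r m))) := by
    intro n m
    refine (isRelFull_preimage hp hloc ((hBo _).inter (hBo _))).exists_comp_eq (hu _ _) (hu _ _)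
      (fun s => ⟨(hα n m s).1.1, (hα n m s).2.1⟩) (fun s => ⟨?_, ?_⟩)
      fun s => ⟨(hα (n + 1) m s).1.2, (hα (n + 1) m s).2.2⟩
    · exact segmentMap_mem (hRc n m) (hfi n m) ⟨hI _, hI _⟩ ⟨hI1 _, hI _⟩ s
    · exact segmentMap_mem (hRc n (m - 1)) (hfi n (m - 1)) ⟨hI _, hI' _⟩ ⟨hI1 _, hI' _⟩ s
  choose g hgA hg using hedge
  choose w hwA hw using hedge'
  -- Followed by the far connecting path, both composites become the near connecting path followed
  -- by the diagonal of the cell. Cancelling gives a homotopy over the good set, which relative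
  -- simple connectedness moves into `A`.
  have hsq : ∀ n m, homIn A (g n m) (hgA n m) ≫ homIn A (w n (m + 1)) (hwA n (m + 1)) =
      homIn A (w n m) (hwA n m) ≫ homIn A (g (n + 1) m) (hgA (n + 1) m) := by
    intro n m
    have e1 := (hg n m).mono (T := p ⁻¹' B (i n m)) fun s hs => hs.1
    have e2 := (hg (n + 1) m).mono (T := p ⁻¹' B (i n m)) fun s hs => hs.2
    have e3 := (hw n m).mono (T := p ⁻¹' B (i n m)) fun s hs => hs.1
    have e4 := (hw n (m + 1)).mono (T := p ⁻¹' B (i n m)) fun s hs => hs.2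
    have a1 := forall_trans_mem_iff.1 e1.mem_left
    have b1 := forall_trans_mem_iff.1 e1.mem_right
    have a2 := forall_trans_mem_iff.1 e2.mem_left
    have b2 := forall_trans_mem_iff.1 e2.mem_right
    have a3 := forall_trans_mem_iff.1 e3.mem_left
    have b3 := forall_trans_mem_iff.1 e3.mem_right
    have a4 := forall_trans_mem_iff.1 e4.mem_left
    have b4 := forall_trans_mem_iff.1 e4.mem_right
    rw [homotopicIn_trans_iff]
    apply (hB (i n m)).homotopicIn (forall_trans_mem_iff.2 ⟨hgA _ _, hwA _ _⟩)
      (forall_trans_mem_iff.2 ⟨hwA _ _, hgA _ _⟩)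
    rw [← homotopicIn_trans_iff a1.1 a4.1 a3.1 a2.1, ← cancel_mono (homIn _ _ a2.2)]
    rw [← homotopicIn_trans_iff a1.1 a1.2 b1.1 b1.2] at e1
    rw [← homotopicIn_trans_iff a2.1 a2.2 b2.1 b2.2] at e2
    rw [← homotopicIn_trans_iff a3.1 a3.2 b3.1 b3.2] at e3
    rw [← homotopicIn_trans_iff a4.1 a4.2 b4.1 b4.2] at e4
    have d1 := homIn_segmentMap_comp (hRc n m) (hfi n m) (a := (r n, r m)) (b := (r n, r (m + 1)))
      (c := (r (n + 1), r (m + 1))) ⟨hI _, hI _⟩ ⟨hI _, hI1 _⟩ ⟨hI1 _, hI1 _⟩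
    have d2 := homIn_segmentMap_comp (hRc n m) (hfi n m) (a := (r n, r m)) (b := (r (n + 1), r m))
      (c := (r (n + 1), r (m + 1))) ⟨hI _, hI _⟩ ⟨hI1 _, hI _⟩ ⟨hI1 _, hI1 _⟩
    simp only [Category.assoc]
    rw [e2, e4, reassoc_of% e1, reassoc_of% e3, d1, d2]
  obtain ⟨G, W, hG0, hG, hW0, hW, hGW⟩ := exists_grid_comp (fun n m => homIn A (g n m) (hgA n m))
    (fun n m => homIn A (w n m) (hwA n m)) hsq
  -- On a side contained in `A`, the original and the pushed edges are homotopic over a good set,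
  -- hence in `A`.
  have hrow : ∀ n, (∀ s, f (r n, s) ∈ A) → ∀ m, ∃ (h₁ : ∀ s, α n m s ∈ A) (h₂ : ∀ s, α n 0 s ∈ A)
      (h₃ : ∀ s, segmentMap f (r n, r 0) (r n, r m) s ∈ A),
      G n m ≫ homIn A _ h₁ = homIn A _ h₂ ≫ homIn A _ h₃ := by
    intro n hn m
    have hC : Convex ℝ (({r n} : Set ℝ) ×ˢ (Set.univ : Set ℝ)) :=
      (convex_singleton _).prod convex_univ
    have hCA : Set.MapsTo f (({r n} : Set ℝ) ×ˢ (Set.univ : Set ℝ)) A := by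
      rintro ⟨a, b⟩ ⟨rfl, -⟩
      exact hn b
    have hmem : ∀ s, (r n, s) ∈ (({r n} : Set ℝ) ×ˢ (Set.univ : Set ℝ)) := fun s => ⟨rfl, trivial⟩
    refine ⟨hαA n m (hn _), hαA n 0 (hn _), segmentMap_mem hC hCA (hmem _) (hmem _), ?_⟩
    induction m with
    | zero => rw [hG0, homIn_segmentMap_self, Category.id_comp, Category.comp_id]
    | succ m ih =>
      have e := (homotopicIn_trans_iff (hgA n m) (hαA n (m + 1) (hn _)) (hαA n m (hn _))
        (segmentMap_mem hC hCA (hmem _) (hmem _))).2 <| (hB (i n m)).homotopicIn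
          (forall_trans_mem_iff.2 ⟨hgA n m, hαA n (m + 1) (hn _)⟩)
          (forall_trans_mem_iff.2 ⟨hαA n m (hn _), segmentMap_mem hC hCA (hmem _) (hmem _)⟩)
          ((hg n m).mono fun s hs => hs.1)
      rw [hG, Category.assoc, e, reassoc_of% ih,
        homIn_segmentMap_comp hC hCA (hmem _) (hmem _) (hmem _)]
  have hcol : ∀ m, (∀ s, f (s, r m) ∈ A) → ∀ n, ∃ (h₁ : ∀ s, α n m s ∈ A) (h₂ : ∀ s, α 0 m s ∈ A)
      (h₃ : ∀ s, segmentMap f (r 0, r m) (r n, r m) s ∈ A),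
      W n m ≫ homIn A _ h₁ = homIn A _ h₂ ≫ homIn A _ h₃ := by
    intro m hm n
    have hC : Convex ℝ ((Set.univ : Set ℝ) ×ˢ ({r m} : Set ℝ)) :=
      convex_univ.prod (convex_singleton _)
    have hCA : Set.MapsTo f ((Set.univ : Set ℝ) ×ˢ ({r m} : Set ℝ)) A := by
      rintro ⟨a, b⟩ ⟨-, rfl⟩
      exact hm a
    have hmem : ∀ s, (s, r m) ∈ ((Set.univ : Set ℝ) ×ˢ ({r m} : Set ℝ)) := fun s => ⟨trivial, rfl⟩
    refine ⟨hαA n m (hm _), hαA 0 m (hm _), segmentMap_mem hC hCA (hmem _) (hmem _), ?_⟩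
    induction n with
    | zero => rw [hW0, homIn_segmentMap_self, Category.id_comp, Category.comp_id]
    | succ n ih =>
      have e := (homotopicIn_trans_iff (hwA n m) (hαA (n + 1) m (hm _)) (hαA n m (hm _))
        (segmentMap_mem hC hCA (hmem _) (hmem _))).2 <| (hB (i n m)).homotopicIn
          (forall_trans_mem_iff.2 ⟨hwA n m, hαA (n + 1) m (hm _)⟩)
          (forall_trans_mem_iff.2 ⟨hαA n m (hm _), segmentMap_mem hC hCA (hmem _) (hmem _)⟩)
          ((hw n m).mono fun s hs => hs.1)
      rw [hW, Category.assoc, e, reassoc_of% ih,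
        homIn_segmentMap_comp hC hCA (hmem _) (hmem _) (hmem _)]
  suffices H : HomotopicIn A
      ((segmentMap f (r 0, r 0) (r 0, r N)).trans (segmentMap f (r 0, r N) (r N, r N)))
      ((segmentMap f (r 0, r 0) (r N, r 0)).trans (segmentMap f (r N, r 0) (r N, r N))) by
    rwa [hr0, hrN] at H
  obtain ⟨h₁, h₂, h₃, e₁⟩ := hrow 0 (by rwa [hr0]) N
  obtain ⟨h₄, h₅, h₆, e₂⟩ := hrow N (by rwa [hrN]) N
  obtain ⟨h₇, h₈, h₉, e₃⟩ := hcol 0 (by rwa [hr0]) N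
  obtain ⟨h₁', h₂', h₃', e₄⟩ := hcol N (by rwa [hrN]) N
  -- The pasted grid compares the pushed sides. Replacing them by the original ones leaves the
  -- connecting path at the initial corner, which cancels.
  rw [← homotopicIn_trans_iff h₃ h₃' h₉ h₆, ← cancel_epi (homIn A _ h₂), ← reassoc_of% e₁, ← e₄,
    ← reassoc_of% e₃, ← e₂, reassoc_of% hGW]

/-- If the preimages of a basis are 2-connected relative to `A`, then paths in `A` that are
homotopic are homotopic in `A`. -/
theorem Homotopic.homotopicIn (hp : Continuous p)
    (hloc : ∀ N : Set Y, IsOpen N → ∀ y ∈ N, ∃ B : Set Y, IsOpen B ∧ y ∈ B ∧ B ⊆ N ∧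
      RelSimplyConnected A (p ⁻¹' B)) {x y : X} {γ γ' : Path x y} (hγ : ∀ t, γ t ∈ A)
    (hγ' : ∀ t, γ' t ∈ A) (h : γ.Homotopic γ') : HomotopicIn A γ γ' := by
  obtain ⟨F⟩ := h
  -- Clamping extends the homotopy to the plane, where straight segments make sense. Two opposite
  -- sides of the square are constant.
  let f : C(ℝ × ℝ, X) := ⟨fun s => F (Set.projIcc 0 1 zero_le_one s.1,
    Set.projIcc 0 1 zero_le_one s.2), by fun_prop⟩
  have hx : x ∈ A := by simpa using hγ 0
  have hy : y ∈ A := by simpa using hγ 1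
  have hl : ∀ s, f (s, 0) = x := fun s => by simp [f]
  have hr : ∀ s, f (s, 1) = y := fun s => by simp [f]
  have hb : ∀ s, f (0, s) = γ (Set.projIcc 0 1 zero_le_one s) := fun s => by simp [f]
  have ht : ∀ s, f (1, s) = γ' (Set.projIcc 0 1 zero_le_one s) := fun s => by simp [f]
  have key := homotopicIn_square hp hloc F.toContinuousMap f (fun _ => rfl) (fun s => hl s ▸ hx)
    (fun s => hr s ▸ hy) (fun s => hb s ▸ hγ _) (fun s => ht s ▸ hγ' _)
  have e1 : segmentMap f (0, 0) (0, 1) = γ.cast (hl 0) (hr 0) := by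
    ext s
    change f (AffineMap.lineMap (0, 0) (0, 1) (s : ℝ)) = γ s
    simp [AffineMap.lineMap_apply, hb]
  have e2 : segmentMap f (1, 0) (1, 1) = γ'.cast (hl 1) (hr 1) := by
    ext s
    change f (AffineMap.lineMap (1, 0) (1, 1) (s : ℝ)) = γ' s
    simp [AffineMap.lineMap_apply, ht]
  have e3 : segmentMap f (0, 0) (1, 0) = (Path.refl x).cast (hl 0) (hl 1) := by
    ext s
    change f (AffineMap.lineMap (0, 0) (1, 0) (s : ℝ)) = x
    simp [AffineMap.lineMap_apply, hl]
  have e4 : segmentMap f (0, 1) (1, 1) = (Path.refl y).cast (hr 0) (hr 1) := by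
    ext s
    change f (AffineMap.lineMap (0, 1) (1, 1) (s : ℝ)) = y
    simp [AffineMap.lineMap_apply, hr]
  rw [e1, e2, e3, e4] at key
  have key' : HomotopicIn A (γ.trans (Path.refl y)) ((Path.refl x).trans γ') := by
    convert key.cast (hl 0).symm (hr 1).symm using 1 <;> ext s <;> simp [Path.trans_apply]
  rw [← homotopicIn_trans_iff hγ (fun _ => hy) (fun _ => hx) hγ'] at key'
  exact homIn_eq_iff.1 ((Category.comp_id (homIn A γ hγ)).symm.trans
    (key'.trans (Category.id_comp (homIn A γ' hγ'))))

end Path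

/-! ### Complements of linear subspaces of codimension at least three -/

theorem isSimplyConnected_iff_homotopicIn {X : Type*} [TopologicalSpace X] {S : Set X} :
    IsSimplyConnected S ↔ IsPathConnected S ∧ ∀ ⦃x y : X⦄ (γ γ' : Path x y),
      (∀ t, γ t ∈ S) → (∀ t, γ' t ∈ S) → Path.HomotopicIn S γ γ' := by
  rw [IsSimplyConnected, simply_connected_iff_paths_homotopic',
    ← isPathConnected_iff_pathConnectedSpace]
  refine and_congr_right fun _ => ⟨fun h x y γ γ' hγ hγ' => ?_, fun h x y γ γ' => ?_⟩
  · exact (Path.codRestrict_homotopic_iff hγ hγ').1 (h _ _)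
  · have := h (γ.map continuous_subtype_val) (γ'.map continuous_subtype_val)
      (fun t => (γ t).2) (fun t => (γ' t).2)
    exact (Path.codRestrict_homotopic_iff _ _).2 this

theorem Convex.isSimplyConnected {V : Type*} [AddCommGroup V] [TopologicalSpace V]
    [IsTopologicalAddGroup V] [Module ℝ V] [ContinuousSMul ℝ V] {C : Set V} (hC : Convex ℝ C)
    (hne : C.Nonempty) : IsSimplyConnected C :=
  isSimplyConnected_iff_homotopicIn.2
    ⟨hC.isPathConnected hne, fun _ _ _ _ h h' => hC.homotopicIn h h'⟩

/-- A point of the triangle is `s • p + t • w` with `w` on the side `[a, b]`. If `f` kills it and `s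
≠ 0`, then `f p` is a multiple of `f w`, contrary to the choice of `p`. -/
theorem convexHull_triple_ne_zero {V Y : Type*} [AddCommGroup V] [Module ℝ V] [AddCommGroup Y]
    [Module ℝ Y] (f : V →ₗ[ℝ] Y) {p a b : V}
    (hab : ∀ w ∈ segment ℝ a b, f w ≠ 0)
    (hp : p ∉ (Submodule.span ℝ {f a, f b}).comap f) {z : V} (hz : z ∈ convexHull ℝ {p, a, b}) :
    f z ≠ 0 := by
  rw [convexHull_insert (Set.insert_nonempty _ _), convexHull_pair, mem_convexJoin] at hz
  obtain ⟨q, rfl, w, hw, hz⟩ := hz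
  obtain ⟨s, t, hs, ht, hst, rfl⟩ := hz
  intro h0
  rcases eq_or_ne s 0 with rfl | hs0
  · rw [zero_add] at hst
    exact hab w hw (by simpa [hst] using h0)
  · apply hp
    have hfw : f w ∈ Submodule.span ℝ {f a, f b} := by
      obtain ⟨c, d, -, -, -, rfl⟩ := hw
      rw [map_add, map_smul, map_smul]
      exact Submodule.mem_span_pair.2 ⟨c, d, rfl⟩
    rw [map_add, map_smul, map_smul] at h0
    have : f q = (-(s⁻¹ * t)) • f w := by
      rw [neg_smul, mul_smul, ← smul_neg, eq_inv_smul_iff₀ hs0]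
      exact eq_neg_of_add_eq_zero_left h0
    rw [Submodule.mem_comap, this]
    exact Submodule.smul_mem _ _ hfw

theorem Submodule.comap_span_pair_ne_top {V Y : Type*} [AddCommGroup V] [Module ℝ V]
    [AddCommGroup Y] [Module ℝ Y] {f : V →ₗ[ℝ] Y} (hf : Function.Surjective f)
    (hY : 2 < Module.finrank ℝ Y) (a b : V) :
    (Submodule.span ℝ {f a, f b}).comap f ≠ ⊤ := by
  intro h
  have htop : Submodule.span ℝ {f a, f b} = ⊤ := by
    rw [← Submodule.map_comap_eq_of_surjective hf (Submodule.span ℝ {f a, f b}), h,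
      Submodule.map_top, LinearMap.range_eq_top.2 hf]
  classical
  have h2 := finrank_span_le_card (R := ℝ) ({f a, f b} : Set Y)
  rw [htop, finrank_top] at h2
  have h3 : ({f a, f b} : Set Y).toFinset.card ≤ 2 := by
    simpa using Finset.card_le_two (a := f a) (b := f b)
  omega

section Complement

variable {V : Type*} [NormedAddCommGroup V] [NormedSpace ℝ V]

/-- Baire: a proper subspace is closed with empty interior, so the complements of countably many
have dense intersection. -/
theorem Submodule.exists_mem_forall_notMem [FiniteDimensional ℝ V] {κ : Type*} [Countable κ]
    {P : κ → Submodule ℝ V}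
    (hP : ∀ j, P j ≠ ⊤) {U : Set V} (hU : IsOpen U) (hne : U.Nonempty) :
    ∃ p ∈ U, ∀ j, p ∉ P j := by
  have : CompleteSpace V := FiniteDimensional.complete ℝ V
  have hd : Dense (⋂ j, ((P j : Set V)ᶜ)) := by
    refine dense_iInter_of_isOpen (fun j => (P j).closed_of_finiteDimensional.isOpen_compl)
      fun j => interior_eq_empty_iff_dense_compl.1 ?_
    by_contra h
    exact hP j ((P j).eq_top_of_nonempty_interior' (Set.nonempty_iff_ne_empty.2 h))
  obtain ⟨p, hp, hpU⟩ := hd.exists_mem_open hU hne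
  exact ⟨p, hpU, fun j => Set.mem_iInter.1 hp j⟩

variable {ι Y : Type*} [AddCommGroup Y] [Module ℝ Y]

/-- Replace `γ` by a polygon and cone it off from `p`: for generic `p` every triangle of the cone
stays in `O`. The excluded subspaces depend on `γ` only, so two paths can share an apex. -/
theorem exists_homotopicIn_segment {C : Set V} (hC : Convex ℝ C) {O : Set V} (hO : IsOpen O)
    (hOC : O ⊆ C) (f : ι → V →ₗ[ℝ] Y) (hOf : ∀ x ∈ C, x ∈ O ↔ ∀ i, f i x ≠ 0)
    (hf : ∀ i, Function.Surjective (f i)) (hY : 2 < Module.finrank ℝ Y) {x y : V} (γ : Path x y)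
    (hγ : ∀ t, γ t ∈ O) :
    ∃ P : ι × ℕ → Submodule ℝ V, (∀ j, P j ≠ ⊤) ∧ ∀ p ∈ C, (∀ j, p ∉ P j) →
      Path.HomotopicIn O ((Path.segment p x).trans γ) (Path.segment p y) := by
  choose ε hε hball using fun z : O => Metric.isOpen_iff.1 hO z z.2
  let F : C(ℝ, V) := ⟨γ.extend, γ.continuous_extend⟩
  obtain ⟨t, ht0, htm, ⟨N, hN⟩, hi⟩ := exists_monotone_Icc_subset_open_cover_unitInterval
    (c := fun i : O => γ ⁻¹' Metric.ball (i : V) (ε i))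
    (fun i => Metric.isOpen_ball.preimage γ.continuous)
    (fun s _ => Set.mem_iUnion.2 ⟨⟨γ s, hγ s⟩, Metric.mem_ball_self (hε _)⟩)
  choose i hi using hi
  have hFO : Set.MapsTo F Set.univ O := fun s _ => hγ (Set.projIcc 0 1 zero_le_one s)
  have hFi : ∀ n, Set.MapsTo F (Set.Icc (t n : ℝ) (t (n + 1))) (Metric.ball (i n : V) (ε (i n))) := by
    intro n s hs
    have hs' : s ∈ I := ⟨(t n).2.1.trans hs.1, hs.2.trans (t (n + 1)).2.2⟩
    have : F s = γ ⟨s, hs'⟩ := γ.extend_apply hs'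
    rw [this]
    exact hi n (show (⟨s, hs'⟩ : I) ∈ _ from hs)
  have hle : ∀ n, (t n : ℝ) ≤ t (n + 1) := fun n => htm n.le_succ
  -- An apex is bad for an edge and an index if its image lies in the span of the images of the
  -- ends. Codimension at least three makes this a proper subspace.
  refine ⟨fun j => (Submodule.span ℝ {f j.1 (F (t j.2)), f j.1 (F (t (j.2 + 1)))}).comap (f j.1),
    fun j => Submodule.comap_span_pair_ne_top (hf _) hY _ _, fun p hp hpP => ?_⟩
  have hseg : ∀ n, segment ℝ (F (t n)) (F (t (n + 1))) ⊆ O := fun n =>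
    ((convex_ball _ _).segment_subset (hFi n ⟨le_rfl, hle n⟩) (hFi n ⟨hle n, le_rfl⟩)).trans
      (hball _)
  have hT : ∀ n, convexHull ℝ {p, F (t n), F (t (n + 1))} ⊆ O := by
    intro n z hz
    have hzC : z ∈ C := by
      refine convexHull_min ?_ hC hz
      rintro _ (rfl | rfl | rfl)
      exacts [hp, hOC (hFO trivial), hOC (hFO trivial)]
    exact (hOf z hzC).2 fun j => convexHull_triple_ne_zero (f j)
      (fun w hw => (hOf w (hOC (hseg n hw))).1 (hseg n hw) j) (hpP (j, n)) hz
  have hpn : ∀ n s, Path.segment p (F (t n)) s ∈ O := fun n s =>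
    hT n ((convex_convexHull ℝ _).lineMap_mem (subset_convexHull ℝ _ (by simp))
      (subset_convexHull ℝ _ (by simp)) s.2)
  have hFs : ∀ a b s, Path.segmentMap F a b s ∈ O := fun a b =>
    Path.segmentMap_mem convex_univ hFO trivial trivial
  have key : ∀ n, Path.homIn O _ (hpn 0) ≫ Path.homIn O _ (hFs (t 0) (t n)) =
      Path.homIn O _ (hpn n) := by
    intro n
    induction n with
    | zero => rw [Path.homIn_segmentMap_self, Category.comp_id]
    | succ n ih =>
      have hsn : ∀ s, Path.segment (F (t n)) (F (t (n + 1))) s ∈ O := fun s =>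
        hseg n (by
          rw [segment_eq_image_lineMap]
          exact ⟨s, s.2, rfl⟩)
      have e1 : Path.homIn O _ (hFs (t n) (t (n + 1))) = Path.homIn O _ hsn := by
        rw [Path.homIn_eq_iff]
        refine ((convex_ball (i n : V) (ε (i n))).homotopicIn ?_ ?_).mono (hball (i n))
        · exact Path.segmentMap_mem (convex_Icc _ _) (hFi n) ⟨le_rfl, hle n⟩ ⟨hle n, le_rfl⟩
        · exact fun s => (convex_ball _ _).lineMap_mem (hFi n ⟨le_rfl, hle n⟩)
            (hFi n ⟨hle n, le_rfl⟩) s.2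
      have e2 : Path.homIn O _ (hpn n) ≫ Path.homIn O _ hsn = Path.homIn O _ (hpn (n + 1)) := by
        rw [← Path.homIn_trans (Path.forall_trans_mem_iff.2 ⟨hpn n, hsn⟩), Path.homIn_eq_iff]
        refine ((convex_convexHull ℝ _).homotopicIn (Path.forall_trans_mem_iff.2 ⟨?_, ?_⟩)
          ?_).mono (hT n) <;>
        exact fun s => (convex_convexHull ℝ _).lineMap_mem (subset_convexHull ℝ _ (by simp))
          (subset_convexHull ℝ _ (by simp)) s.2
      rw [← Path.homIn_segmentMap_comp convex_univ hFO (a := (t 0 : ℝ)) (b := (t n : ℝ)) trivial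
        trivial trivial, reassoc_of% ih, e1, e2]
  have hk := key N
  rw [← Path.homIn_trans (Path.forall_trans_mem_iff.2 ⟨hpn 0, hFs _ _⟩), Path.homIn_eq_iff,
    show (t 0 : ℝ) = 0 by simp [ht0], show (t N : ℝ) = 1 by simp [hN N le_rfl]] at hk
  have hF0 : F 0 = x := γ.extend_zero
  have hF1 : F 1 = y := γ.extend_one
  convert hk.cast rfl hF1.symm using 1
  · ext s
    simp only [Path.cast_coe, Path.trans_apply]
    split_ifs
    · simp [hF0]
    · change γ _ = γ.extend (AffineMap.lineMap (0 : ℝ) 1 ((_ : I) : ℝ))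
      rw [AffineMap.lineMap_apply]
      simpa using (γ.extend_apply _).symm
  · ext s
    simp

/-- The complement in a nonempty open convex set of finitely many linear subspaces of codimension
at least three is simply connected. -/
theorem Convex.isSimplyConnected_setOf_forall_ne_zero [FiniteDimensional ℝ V] [Finite ι] {C : Set V}
    (hC : Convex ℝ C)
    (hCo : IsOpen C) (hne : C.Nonempty) (f : ι → V →ₗ[ℝ] Y)
    (hf : ∀ i, Function.Surjective (f i)) (hY : 2 < Module.finrank ℝ Y) :
    IsSimplyConnected {x ∈ C | ∀ i, f i x ≠ 0} := by
  set O := {x ∈ C | ∀ i, f i x ≠ 0} with hOdef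
  have hOC : O ⊆ C := fun x hx => hx.1
  have hOf : ∀ x ∈ C, x ∈ O ↔ ∀ i, f i x ≠ 0 := fun x hx => ⟨fun h => h.2, fun h => ⟨hx, h⟩⟩
  have hO : IsOpen O := by
    have : O = C ∩ ⋂ i, ((LinearMap.ker (f i) : Set V)ᶜ) := by
      ext x
      simp [O]
    rw [this]
    exact hCo.inter (isOpen_iInter_of_finite fun i =>
      (LinearMap.ker (f i)).closed_of_finiteDimensional.isOpen_compl)
  have main : ∀ {x y x' y' : V} (γ : Path x y) (γ' : Path x' y'), (∀ t, γ t ∈ O) →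
      (∀ t, γ' t ∈ O) → ∃ p ∈ O, Path.HomotopicIn O ((Path.segment p x).trans γ)
        (Path.segment p y) ∧ Path.HomotopicIn O ((Path.segment p x').trans γ')
        (Path.segment p y') := by
    intro x y x' y' γ γ' hγ hγ'
    obtain ⟨P, hP, hP'⟩ := exists_homotopicIn_segment hC hO hOC f hOf hf hY γ hγ
    obtain ⟨Q, hQ, hQ'⟩ := exists_homotopicIn_segment hC hO hOC f hOf hf hY γ' hγ'
    -- One apex, generic for both paths at once.
    obtain ⟨p, hpC, hp⟩ := Submodule.exists_mem_forall_notMem (P := Sum.elim P Q)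
      (by rintro (j | j); exacts [hP j, hQ j]) hCo hne
    have h1 := hP' p hpC fun j => hp (.inl j)
    refine ⟨p, ?_, h1, hQ' p hpC fun j => hp (.inr j)⟩
    simpa using h1.mem_right 0
  refine isSimplyConnected_iff_homotopicIn.2 ⟨?_, fun x y γ γ' hγ hγ' => ?_⟩
  · have hne' : O.Nonempty := by
      obtain ⟨p, hpC, hp⟩ := Submodule.exists_mem_forall_notMem
        (P := fun i => LinearMap.ker (f i)) (fun i h => by
          have : Nontrivial Y := Module.nontrivial_of_finrank_pos (R := ℝ) (by omega)
          obtain ⟨y, hy⟩ := exists_ne (0 : Y)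
          obtain ⟨x, rfl⟩ := hf i y
          exact hy (LinearMap.mem_ker.1 (h ▸ Submodule.mem_top))) hCo hne
      exact ⟨p, hpC, fun i => hp i⟩
    refine isPathConnected_iff.2 ⟨hne', fun x hx y hy => ?_⟩
    obtain ⟨p, hp, h1, h2⟩ := main (Path.refl x) (Path.refl y) (fun _ => hx) (fun _ => hy)
    exact (JoinedIn.symm ⟨_, h1.mem_right⟩).trans ⟨_, h2.mem_right⟩
  · obtain ⟨p, hp, h1, h2⟩ := main γ γ' hγ hγ'
    have hx := (Path.forall_trans_mem_iff.1 h1.mem_left).1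
    rw [← Path.homIn_eq_iff (h := Path.forall_trans_mem_iff.2 ⟨hx, hγ⟩) (h' := h1.mem_right),
      Path.homIn_trans] at h1
    rw [← Path.homIn_eq_iff (h := Path.forall_trans_mem_iff.2 ⟨hx, hγ'⟩) (h' := h2.mem_right),
      Path.homIn_trans] at h2
    rw [← Path.homIn_eq_iff (h := hγ) (h' := hγ'), ← cancel_epi (Path.homIn O _ hx), h1, h2]

end Complement

end RelativeFundamentalGroupoid

/-! ### Transport along homeomorphisms and local trivializations -/

theorem IsSimplyConnected.of_invOn {Y Z : Type*} [TopologicalSpace Y] [TopologicalSpace Z]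
    {S : Set Y} {T : Set Z} (h : IsSimplyConnected T) {φ : Y → Z} {ψ : Z → Y}
    (hφ : ContinuousOn φ S) (hψ : ContinuousOn ψ T) (hST : Set.MapsTo φ S T)
    (hTS : Set.MapsTo ψ T S) (hinv : Set.InvOn ψ φ S T) : IsSimplyConnected S := by
  let e : S ≃ₜ T :=
    { toFun := hST.restrict φ S T
      invFun := hTS.restrict ψ T S
      left_inv := fun x => Subtype.ext (hinv.1 x.2)
      right_inv := fun x => Subtype.ext (hinv.2 x.2)
      continuous_toFun := hφ.mapsToRestrict hST
      continuous_invFun := hψ.mapsToRestrict hTS }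
  have := h.simplyConnectedSpace
  exact e.toHomotopyEquiv.simplyConnectedSpace

/-- The preimage, under a map that is trivial over `B`, of a simply connected pair `(B, B ∩ U)`. -/
theorem Path.relSimplyConnected_preimage {X Y Z : Type*} [TopologicalSpace X] [TopologicalSpace Y]
    [TopologicalSpace Z] {p : X → Y} (hp : Continuous p) {U B : Set Y} {f : X → Z} {g : Y × Z → X}
    (hf : ContinuousOn f (p ⁻¹' B)) (hg : ContinuousOn g (B ×ˢ Set.univ))
    (hpg : ∀ y ∈ B, ∀ z, p (g (y, z)) = y) (hgf : ∀ x ∈ p ⁻¹' B, g (p x, f x) = x)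
    (hB : IsSimplyConnected B) (hBU : IsSimplyConnected (B ∩ U)) :
    Path.RelSimplyConnected (p ⁻¹' U) (p ⁻¹' B) := by
  rw [isSimplyConnected_iff_homotopicIn] at hB hBU
  refine ⟨fun x hx => ?_, fun x y γ hx hy hγ => ?_, fun {x y γ γ'} hγ hγ' ⟨H, hH⟩ => ?_⟩
  · obtain ⟨b, hbB, hbU⟩ := hBU.1.nonempty
    obtain ⟨β, hβ⟩ := hB.1.joinedIn b hbB (p x) hx
    -- The base point moves along `β` while the fibre coordinate stays fixed.
    refine ⟨g (b, f x), ?_, ⟨⟨fun t => g (β t, f x), ?_⟩, ?_, ?_⟩, fun t => ?_⟩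
    · rwa [Set.mem_preimage, hpg b hbB]
    · exact hg.comp_continuous (by fun_prop) fun t => ⟨hβ t, trivial⟩
    · simp
    · simp [hgf x hx]
    · change p (g (β t, f x)) ∈ B
      rw [hpg _ (hβ t)]
      exact hβ t
  · have hxB : x ∈ p ⁻¹' B := by simpa using hγ 0
    have hyB : y ∈ p ⁻¹' B := by simpa using hγ 1
    obtain ⟨β, hβ⟩ := hBU.1.joinedIn (p x) ⟨hxB, hx⟩ (p y) ⟨hyB, hy⟩
    obtain ⟨K, hK⟩ := hB.2 β (γ.map hp) (fun t => (hβ t).1) hγ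
    have hfγ : Continuous fun t => f (γ t) := hf.comp_continuous γ.continuous hγ
    -- Only the base component is replaced; the fibre component of `γ` is kept throughout.
    refine ⟨⟨⟨fun t => g (β t, f (γ t)), ?_⟩, ?_, ?_⟩, fun t => ?_,
      ⟨⟨⟨fun s => g (K s, f (γ s.2)), ?_⟩, ?_, ?_⟩, ?_⟩, fun s => ?_⟩
    · exact hg.comp_continuous (β.continuous.prodMk hfγ) fun t => ⟨(hβ t).1, trivial⟩
    · simp [hgf x hxB]
    · simp [hgf y hyB]
    · change p (g (β t, f (γ t))) ∈ U
      rw [hpg _ (hβ t).1]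
      exact (hβ t).2
    · exact hg.comp_continuous (K.continuous.prodMk (hfγ.comp continuous_snd)) fun t => ⟨hK t, trivial⟩
    · intro t
      simp
    · intro t
      simp [hgf _ (hγ t)]
    · rintro s t (rfl | rfl) <;> simp
    · change p (g (K s, f (γ s.2))) ∈ B
      rw [hpg _ (hK s)]
      exact hK s
  · have hγB : ∀ t, γ t ∈ p ⁻¹' B := fun t => by simpa using hH (0, t)
    have hγ'B : ∀ t, γ' t ∈ p ⁻¹' B := fun t => by simpa using hH (1, t)
    have hxB : x ∈ p ⁻¹' B := by simpa using hγB 0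
    have hyB : y ∈ p ⁻¹' B := by simpa using hγB 1
    obtain ⟨K, hK⟩ := hBU.2 (γ.map hp) (γ'.map hp) (fun t => ⟨hγB t, hγ t⟩)
      fun t => ⟨hγ'B t, hγ' t⟩
    have hfH : Continuous fun s => f (H s) := hf.comp_continuous H.continuous hH
    refine ⟨⟨⟨⟨fun s => g (K s, f (H s)), ?_⟩, ?_, ?_⟩, ?_⟩, fun s => ?_⟩
    · exact hg.comp_continuous (K.continuous.prodMk hfH) fun t => ⟨(hK t).1, trivial⟩
    · intro t
      simp [hgf _ (hγB t)]
    · intro t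
      simp [hgf _ (hγ'B t)]
    · rintro s t (rfl | rfl)
      · simp [hgf _ hxB]
      · simp [hgf _ hyB]
    · change p (g (K s, f (H s))) ∈ U
      rw [hpg _ (hK s).1]
      exact (hK s).2

/-! ### Boxes in powers of a manifold with boundary -/

section Box

variable {d : ℕ} [NeZero d] {W : Type*} [TopologicalSpace W]
  [ChartedSpace (EuclideanHalfSpace d) W]

/-- Any chart of the atlas detects interior points, and inside the chart they are those with
positive first coordinate. The centre `w` may itself lie on the boundary. -/
theorem exists_chart_box [IsManifold (𝓡∂ d) ∞ W] (w : W) {O : Set W} (hO : O ∈ nhds w) :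
    ∃ r > 0, Metric.ball (extChartAt (𝓡∂ d) w w) r ∩ {x | 0 ≤ x 0} ⊆
        (extChartAt (𝓡∂ d) w).target ∩ (extChartAt (𝓡∂ d) w).symm ⁻¹' O ∧
      ∀ z ∈ (extChartAt (𝓡∂ d) w).source, extChartAt (𝓡∂ d) w z ∈
        Metric.ball (extChartAt (𝓡∂ d) w w) r →
        (z ∈ (𝓡∂ d).interior W ↔ 0 < extChartAt (𝓡∂ d) w z 0) := by
  have hrange : Set.range (𝓡∂ d) = {x | 0 ≤ x 0} := range_modelWithCornersEuclideanHalfSpace d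
  obtain ⟨r, hr, hr'⟩ := Metric.mem_nhdsWithin_iff.1
    (Filter.inter_mem (extChartAt_target_mem_nhdsWithin (I := 𝓡∂ d) w)
      (mem_nhdsWithin_of_mem_nhds ((continuousAt_extChartAt_symm (I := 𝓡∂ d) w).preimage_mem_nhds
        (by rwa [extChartAt_to_inv]))))
  rw [hrange] at hr'
  refine ⟨r, hr, hr', fun z hz hzr => ?_⟩
  have h1 := (𝓡∂ d).isInteriorPoint_iff_of_mem_atlas (n := ∞) (M := W) (by simp)
    (chart_mem_atlas (EuclideanHalfSpace d) w) (x := z) (by simpa using hz)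
  refine Iff.trans h1 ⟨fun h => ?_, fun h => ?_⟩
  · have h2 := interior_mono (extChartAt_target_subset_range (I := 𝓡∂ d) w) h
    rwa [hrange, interior_halfSpace] at h2
  · refine mem_interior.2 ⟨Metric.ball (extChartAt (𝓡∂ d) w w) r ∩ {x | 0 < x 0},
      fun x hx => (hr' ⟨hx.1, (show 0 < x 0 from hx.2).le⟩).1, ?_, hzr, h⟩
    exact Metric.isOpen_ball.inter (isOpen_lt continuous_const (by fun_prop))

/-- Tuples of distinct interior points of a manifold. -/
def distinctInterior (d : ℕ) [NeZero d] (W : Type*) [TopologicalSpace W]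
    [ChartedSpace (EuclideanHalfSpace d) W] (k : ℕ) : Set (Fin k → W) :=
  {w | (∀ i, w i ∈ (𝓡∂ d).interior W) ∧ ∀ i j, i ≠ j → w i ≠ w j}

theorem exists_isSimplyConnected_box (hd : 3 ≤ d) [T2Space W] [IsManifold (𝓡∂ d) ∞ W] {k : ℕ}
    {N : Set (Fin k → W)} (hN : IsOpen N) {w : Fin k → W} (hw : w ∈ N) :
    ∃ B : Set (Fin k → W), IsOpen B ∧ w ∈ B ∧ B ⊆ N ∧ IsSimplyConnected B ∧
      IsSimplyConnected (B ∩ distinctInterior d W k) := by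
  obtain ⟨O, hO, hON⟩ := isOpen_pi_iff'.1 hN w hw
  obtain ⟨D, hD, hDd⟩ := (Set.finite_range w).t2_separation
  choose r hr hr1 hr2 using fun i => exists_chart_box (d := d) (w i) (O := O i ∩ D (w i))
    (((hO i).1.inter (hD _).2).mem_nhds ⟨(hO i).2, (hD _).1⟩)
  let e := fun i => extChartAt (𝓡∂ d) (w i)
  let b := fun i => Metric.ball (e i (w i)) (r i)
  have hrange : Set.range (𝓡∂ d) = {x | 0 ≤ x 0} := range_modelWithCornersEuclideanHalfSpace d
  let B : Set (Fin k → W) := Set.pi Set.univ fun i => (e i).source ∩ e i ⁻¹' b i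
  let T : Set (Fin k → EuclideanSpace ℝ (Fin d)) := Set.pi Set.univ fun i => b i ∩ {x | 0 ≤ x 0}
  let C : Set (Fin k → EuclideanSpace ℝ (Fin d)) := Set.pi Set.univ fun i => b i ∩ {x | 0 < x 0}
  let Φ : (Fin k → W) → Fin k → EuclideanSpace ℝ (Fin d) := fun z i => e i (z i)
  let Ψ : (Fin k → EuclideanSpace ℝ (Fin d)) → Fin k → W := fun x i => (e i).symm (x i)
  have hBD : ∀ i, ∀ z ∈ (e i).source ∩ e i ⁻¹' b i, z ∈ O i ∩ D (w i) := by
    intro i z hz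
    have := (hr1 i ⟨hz.2, hrange ▸ extChartAt_target_subset_range (I := 𝓡∂ d) (w i)
      ((e i).map_source hz.1)⟩).2
    rwa [Set.mem_preimage, (e i).left_inv hz.1] at this
  have hwB : w ∈ B := fun i _ => ⟨mem_extChartAt_source (w i), Metric.mem_ball_self (hr i)⟩
  have hΦ : ContinuousOn Φ B := continuousOn_pi.2 fun i =>
    (continuousOn_extChartAt (w i)).comp (continuous_apply i).continuousOn
      fun z hz => (hz i trivial).1
  have hΨ : ContinuousOn Ψ T := continuousOn_pi.2 fun i =>
    (continuousOn_extChartAt_symm (w i)).comp (continuous_apply i).continuousOn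
      fun z hz => (hr1 i (hz i trivial)).1
  have hBT : Set.MapsTo Φ B T := fun z hz i _ => ⟨(hz i trivial).2,
    hrange ▸ extChartAt_target_subset_range (I := 𝓡∂ d) (w i) ((e i).map_source (hz i trivial).1)⟩
  have hTB : Set.MapsTo Ψ T B := fun x hx i _ => by
    have hxt := (hr1 i (hx i trivial)).1
    refine ⟨(e i).map_target hxt, ?_⟩
    rw [Set.mem_preimage, (e i).right_inv hxt]
    exact (hx i trivial).1
  have hinv : Set.InvOn Ψ Φ B T := ⟨fun z hz => funext fun i => (e i).left_inv (hz i trivial).1,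
    fun x hx => funext fun i => (e i).right_inv (hr1 i (hx i trivial)).1⟩
  have hCT : C ⊆ T := Set.pi_mono fun i _ => Set.inter_subset_inter_right _
    fun x (hx : 0 < x 0) => hx.le
  -- Particles with different centres are kept apart by the disjoint sets `D`. Those with the same
  -- centre use the same chart, so a collision is a linear condition.
  let ι := {ij : Fin k × Fin k // ij.1 ≠ ij.2 ∧ w ij.1 = w ij.2}
  let f : ι → (Fin k → EuclideanSpace ℝ (Fin d)) →ₗ[ℝ] EuclideanSpace ℝ (Fin d) :=
    fun ij => LinearMap.proj (R := ℝ) (φ := fun _ : Fin k => EuclideanSpace ℝ (Fin d)) ij.1.1 -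
      LinearMap.proj ij.1.2
  have hBU : ∀ z ∈ B, z ∈ distinctInterior d W k ↔ Φ z ∈ {x ∈ C | ∀ ij, f ij x ≠ 0} := by
    intro z hz
    have hint : ∀ i, z i ∈ (𝓡∂ d).interior W ↔ 0 < Φ z i 0 := fun i =>
      hr2 i (z i) (hz i trivial).1 (hz i trivial).2
    have hne : (∀ i j, i ≠ j → z i ≠ z j) ↔ ∀ ij, f ij (Φ z) ≠ 0 := by
      refine ⟨fun h ij h0 => h _ _ ij.2.1 ?_, fun h i j hij hz' => ?_⟩
      · obtain ⟨⟨i, j⟩, hij, hwij⟩ := ij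
        have h0' : extChartAt (𝓡∂ d) (w i) (z i) = extChartAt (𝓡∂ d) (w j) (z j) :=
          sub_eq_zero.1 h0
        have hj := (hz j trivial).1
        simp only [e] at hj
        rw [← hwij] at h0' hj
        exact (e i).injOn (hz i trivial).1 hj h0'
      · by_cases hwij : w i = w j
        · refine h ⟨(i, j), hij, hwij⟩ ?_
          change extChartAt (𝓡∂ d) (w i) (z i) - extChartAt (𝓡∂ d) (w j) (z j) = 0
          rw [hz', hwij, sub_self]
        · refine Set.disjoint_left.1 (hDd ⟨i, rfl⟩ ⟨j, rfl⟩ hwij) (hBD i _ (hz i trivial)).2 ?_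
          rw [hz']
          exact (hBD j _ (hz j trivial)).2
    refine and_congr ?_ hne
    simp only [hint]
    exact ⟨fun h i _ => ⟨(hz i trivial).2, h i⟩, fun h i => (h i trivial).2⟩
  have hcoord : IsOpen {x : EuclideanSpace ℝ (Fin d) | 0 < x 0} :=
    isOpen_lt continuous_const (by fun_prop)
  have hpos : Convex ℝ {x : EuclideanSpace ℝ (Fin d) | 0 < x 0} :=
    convex_halfSpace_gt (f := fun x : EuclideanSpace ℝ (Fin d) => x 0) ⟨fun _ _ => rfl, fun _ _ => rfl⟩ 0
  have hTc : Convex ℝ T := convex_pi fun i _ => (convex_ball _ _).inter EuclideanHalfSpace.convex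
  have hCc : Convex ℝ C := convex_pi fun i _ => (convex_ball _ _).inter hpos
  have hCo : IsOpen C := isOpen_set_pi Set.finite_univ fun i _ => Metric.isOpen_ball.inter hcoord
  have hCne : C.Nonempty := by
    refine Set.univ_pi_nonempty_iff.2 fun i => ?_
    -- The centre may be a boundary point, but it is a limit of points of the open half-space.
    have hcl : e i (w i) ∈ closure {x : EuclideanSpace ℝ (Fin d) | 0 < x 0} := by
      rw [closure_open_halfSpace, ← hrange]
      exact Set.mem_range_self _
    obtain ⟨x, hx, hx'⟩ := Metric.mem_closure_iff.1 hcl (r i) (hr i)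
    exact ⟨x, by rwa [Metric.mem_ball, dist_comm], hx⟩
  refine ⟨B, ?_, hwB, ?_, ?_, ?_⟩
  · exact isOpen_set_pi Set.finite_univ fun i _ =>
      isOpen_extChartAt_preimage' (I := 𝓡∂ d) (w i) Metric.isOpen_ball
  · exact fun z hz => hON fun i _ => (hBD i _ (hz i trivial)).1
  · exact (hTc.isSimplyConnected ⟨_, hBT hwB⟩).of_invOn hΦ hΨ hBT hTB hinv
  · have hsc := hCc.isSimplyConnected_setOf_forall_ne_zero hCo hCne f (fun ij y => by
      refine ⟨Pi.single ij.1.1 y, ?_⟩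
      simp [f, Pi.single_eq_of_ne ij.2.1.symm]) (by
        rw [finrank_euclideanSpace_fin]
        omega)
    refine hsc.of_invOn (hΦ.mono Set.inter_subset_left) (hΨ.mono fun x hx => hCT hx.1)
      (fun z hz => (hBU z hz.1).1 hz.2) (fun x hx => ?_)
      (hinv.mono Set.inter_subset_left fun x hx => hCT hx.1)
    refine ⟨hTB (hCT hx.1), (hBU _ (hTB (hCT hx.1))).2 ?_⟩
    rw [hinv.2 (hCT hx.1)]
    exact hx

end Box

/-! ### Path-connectedness of the total space -/

namespace IsFibreBundle

variable {F E B : Type*} [TopologicalSpace F] [TopologicalSpace E] [TopologicalSpace B] {π : E → B}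

theorem continuous (hπ : IsFibreBundle F π) : Continuous π := by
  refine continuous_iff_continuousAt.2 fun e => ?_
  obtain ⟨t, ht⟩ := hπ (π e)
  exact t.continuousAt_proj (t.mem_source.2 ht)

/-- That every point over `x` is joined to every point over `y` is a transitive relation, since
fibres are nonempty. It holds locally by a trivialization, so connectedness of `B` spreads it. -/
theorem pathConnectedSpace [PathConnectedSpace F] [PathConnectedSpace B] [LocallyPathConnectedSpace B]
    (hπ : IsFibreBundle F π) : PathConnectedSpace E := by
  have hsurj : ∀ b, ∃ e, π e = b := by
    intro b
    obtain ⟨t, ht⟩ := hπ b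
    obtain ⟨f⟩ := (inferInstance : Nonempty F)
    exact ⟨t.toOpenPartialHomeomorph.symm (b, f), t.proj_symm_apply' ht⟩
  have key : ∀ x y : B, ∀ e e' : E, π e = x → π e' = y → Joined e e' := by
    refine PreconnectedSpace.induction₂' _ (fun x => ?_) ?_
    · obtain ⟨t, ht⟩ := hπ x
      have hU := locallyPathConnectedSpace_iff_isOpen_pathComponentIn.1 ‹_› x t.baseSet t.open_baseSet
      filter_upwards [hU.mem_nhds (mem_pathComponentIn_self ht)] with y hy
      have hloc : ∀ e e' : E, π e = x → π e' = y → Joined e e' := by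
        rintro e e' he he'
        obtain ⟨γ, hγ⟩ := hy
        obtain ⟨δ⟩ := PathConnectedSpace.joined (t e).2 (t e').2
        have hc : Continuous fun s => t.toOpenPartialHomeomorph.symm (γ s, δ s) :=
          t.toOpenPartialHomeomorph.continuousOn_symm.comp_continuous
            (γ.continuous.prodMk δ.continuous) fun s => t.mem_target.2 (hγ s)
        refine ⟨⟨⟨_, hc⟩, ?_, ?_⟩⟩
        · simp only [Path.source, ← he]
          exact t.symm_apply_mk_proj (t.mem_source.2 (he ▸ ht))
        · simp only [Path.target, ← he']
          exact t.symm_apply_mk_proj (t.mem_source.2 (he' ▸ by simpa using hγ 1))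
      exact ⟨hloc, fun e e' he he' => (hloc e' e he' he).symm⟩
    · refine ⟨fun x y z hxy hyz e e' he he' => ?_⟩
      obtain ⟨m, hm⟩ := hsurj y
      exact (hxy e m he hm).trans (hyz m e' hm he')
  obtain ⟨b⟩ := (inferInstance : Nonempty B)
  obtain ⟨e, -⟩ := hsurj b
  exact ⟨⟨e⟩, fun e e' => key _ _ e e' rfl rfl⟩

end IsFibreBundle

/-! ### Configurations as a subspace of the space of labels -/

section Labels

variable {d : ℕ} [NeZero d] {W : Type*} [TopologicalSpace W] [ChartedSpace (EuclideanHalfSpace d) W]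
  {F E : Type*} [TopologicalSpace F] [TopologicalSpace E] {π : E → W} {k : ℕ}

theorem IsFibreBundle.exists_relSimplyConnected [T2Space W] [IsManifold (𝓡∂ d) ∞ W] (hd : 3 ≤ d)
    (hπ : IsFibreBundle F π) (N : Set (Fin k → W)) (hN : IsOpen N) (w : Fin k → W) (hw : w ∈ N) :
    ∃ B : Set (Fin k → W), IsOpen B ∧ w ∈ B ∧ B ⊆ N ∧
      Path.RelSimplyConnected ((fun (x : Fin k → E) i => π (x i)) ⁻¹' distinctInterior d W k)
        ((fun (x : Fin k → E) i => π (x i)) ⁻¹' B) := by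
  choose t ht using fun i => hπ (w i)
  obtain ⟨B, hBo, hwB, hBN, hB, hBU⟩ := exists_isSimplyConnected_box (d := d) hd
    (N := N ∩ Set.pi Set.univ fun i => (t i).baseSet)
    (hN.inter (isOpen_set_pi Set.finite_univ fun i _ => (t i).open_baseSet))
    ⟨hw, fun i _ => ht i⟩
  have hBt : ∀ z ∈ B, ∀ i, z i ∈ (t i).baseSet := fun z hz i => (hBN hz).2 i trivial
  refine ⟨B, hBo, hwB, fun z hz => (hBN hz).1, Path.relSimplyConnected_preimage
    (Z := Fin k → F) (f := fun x i => (t i (x i)).2)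
    (g := fun yz i => (t i).toOpenPartialHomeomorph.symm (yz.1 i, yz.2 i)) ?_ ?_ ?_ ?_ ?_ hB hBU⟩
  · exact continuous_pi fun i => hπ.continuous.comp (continuous_apply i)
  · refine continuousOn_pi.2 fun i => continuous_snd.comp_continuousOn ?_
    have hti : ContinuousOn (t i) (t i).toOpenPartialHomeomorph.source :=
      (t i).toOpenPartialHomeomorph.continuousOn
    exact hti.comp (f := fun x : Fin k → E => x i)
      (continuous_apply i).continuousOn fun (x : Fin k → E) hx =>
      (t i).mem_source.2 (show π (x i) ∈ _ from hBt _ hx i)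
  · refine continuousOn_pi.2 fun i => ?_
    exact (t i).toOpenPartialHomeomorph.continuousOn_symm.comp (by fun_prop) fun x hx =>
      (t i).mem_target.2 (hBt _ hx.1 i)
  · exact fun y hy z => funext fun i => (t i).proj_symm_apply' (hBt y hy i)
  · exact fun x hx => funext fun i => (t i).symm_apply_mk_proj ((t i).mem_source.2 (hBt _ hx i))

/-- The labels of a configuration, which determine it. -/
def OrderedConfig.labels (z : OrderedConfig d π k) : Fin k → E := z.1.2

/-- The particles are recovered continuously from the labels by applying `π`. -/
theorem OrderedConfig.isEmbedding_labels (hπ : Continuous π) :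
    Topology.IsEmbedding (OrderedConfig.labels : OrderedConfig d π k → Fin k → E) := by
  have h : Topology.IsEmbedding fun z : OrderedConfig d π k =>
      ((fun i => (z.1.1 i : W), z.1.2) : (Fin k → W) × (Fin k → E)) :=
    ((Topology.IsEmbedding.piMap fun _ : Fin k => Topology.IsEmbedding.subtypeVal).prodMap
      Topology.IsEmbedding.id).comp Topology.IsEmbedding.subtypeVal
  have hc : Continuous (OrderedConfig.labels : OrderedConfig d π k → Fin k → E) :=
    continuous_snd.comp continuous_subtype_val
  refine Topology.IsEmbedding.of_comp hc
    (g := fun x : Fin k → E => ((fun i => π (x i), x) : (Fin k → W) × (Fin k → E)))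
    (by fun_prop) ?_
  convert h using 1
  exact funext fun z => Prod.ext (funext fun i => z.2.1 i) rfl

theorem OrderedConfig.range_labels {E : Type*} {π : E → W} :
    Set.range (OrderedConfig.labels : OrderedConfig d π k → Fin k → E) =
      (fun (x : Fin k → E) i => π (x i)) ⁻¹' distinctInterior d W k := by
  refine Set.Subset.antisymm ?_ fun x hx => ?_
  · rintro _ ⟨z, rfl⟩
    refine ⟨fun i => ?_, fun i j hij => ?_⟩
    · change π (z.1.2 i) ∈ (𝓡∂ d).interior W
      rw [z.2.1 i]
      exact (z.1.1 i).2
    · change π (z.1.2 i) ≠ π (z.1.2 j)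
      rw [z.2.1 i, z.2.1 j]
      exact fun h => z.2.2 i j hij (Subtype.ext h)
  · exact ⟨⟨(fun i => ⟨π (x i), hx.1 i⟩, x), fun _ => rfl,
      fun i j hij h => hx.2 i j hij (congrArg Subtype.val h)⟩, rfl⟩

theorem Topology.IsEmbedding.map_quotient_bijective {Z X : Type*} [TopologicalSpace Z]
    [TopologicalSpace X] {j : Z → X} (hj : Topology.IsEmbedding j)
    (hfull : Path.IsRelFull (Set.range j) Set.univ)
    (hfaith : ∀ ⦃x y : X⦄ (γ γ' : Path x y), (∀ t, γ t ∈ Set.range j) →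
      (∀ t, γ' t ∈ Set.range j) → γ.Homotopic γ' → Path.HomotopicIn (Set.range j) γ γ') (z z' : Z) :
    Function.Bijective fun γ : Path.Homotopic.Quotient z z' => γ.map ⟨j, hj.continuous⟩ := by
  let e := hj.toHomeomorph
  have he : ∀ y, j (e.symm y) = y := fun y => congrArg Subtype.val (e.apply_symm_apply y)
  constructor
  · intro γ γ'
    induction γ, γ' using Path.Homotopic.Quotient.ind₂ with | _ γ γ' =>
    intro h
    have h' : (γ.map hj.continuous).Homotopic (γ'.map hj.continuous) :=
      Path.Homotopic.Quotient.exact h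
    obtain ⟨F, hF⟩ := hfaith _ _ (fun t => ⟨γ t, rfl⟩) (fun t => ⟨γ' t, rfl⟩) h'
    refine Path.Homotopic.Quotient.eq.2 ⟨⟨⟨⟨fun s => e.symm ⟨F s, hF s⟩, ?_⟩, ?_, ?_⟩, ?_⟩⟩
    · exact e.symm.continuous.comp (F.continuous.subtype_mk _)
    · exact fun t => hj.injective ((he _).trans (by simp))
    · exact fun t => hj.injective ((he _).trans (by simp))
    · rintro s t (rfl | rfl) <;> exact hj.injective ((he _).trans (by simp))
  · intro γ
    induction γ using Path.Homotopic.Quotient.ind with | _ γ =>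
    obtain ⟨γ', hγ', h⟩ := hfull γ ⟨z, rfl⟩ ⟨z', rfl⟩ fun _ => trivial
    refine ⟨.mk ⟨⟨fun t => e.symm ⟨γ' t, hγ' t⟩, ?_⟩, ?_, ?_⟩, ?_⟩
    · exact e.symm.continuous.comp (γ'.continuous.subtype_mk _)
    · exact hj.injective ((he _).trans (by simp))
    · exact hj.injective ((he _).trans (by simp))
    · refine Path.Homotopic.Quotient.eq.2 ?_
      convert h.homotopic
      ext t
      exact he _

/-- Homotopy classes of paths of ordered configurations are the same as homotopy classes of paths
of tuples of labels. -/
theorem OrderedConfig.map_labels_bijective [T2Space W] [IsManifold (𝓡∂ d) ∞ W] (hd : 3 ≤ d)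
    (hπ : IsFibreBundle F π) (z z' : OrderedConfig d π k) :
    Function.Bijective fun γ : Path.Homotopic.Quotient z z' =>
      γ.map ⟨OrderedConfig.labels, (OrderedConfig.isEmbedding_labels hπ.continuous).continuous⟩ := by
  have hp : Continuous fun (x : Fin k → E) i => π (x i) :=
    continuous_pi fun i => hπ.continuous.comp (continuous_apply i)
  have hloc := hπ.exists_relSimplyConnected (k := k) hd
  refine (OrderedConfig.isEmbedding_labels hπ.continuous).map_quotient_bijective ?_ ?_ z z' <;>
  rw [OrderedConfig.range_labels]
  · exact Path.isRelFull_preimage hp hloc isOpen_univ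
  · exact fun x y γ γ' hγ hγ' h => h.homotopicIn hp hloc hγ hγ'

end Labels

/-! ### The covering of unordered by ordered configurations -/

section Covering

variable {d : ℕ} [NeZero d] {W E : Type*} [TopologicalSpace W]
  [ChartedSpace (EuclideanHalfSpace d) W] [TopologicalSpace E] {π : E → W} {k : ℕ}

/-- Put disjoint neighbourhoods around the distinct particles. If `z'` and `σ • z'` both have their
`i`-th particle in the `i`-th neighbourhood for all `i`, then `σ` fixes every index. -/
theorem OrderedConfig.isQuotientCoveringMap [T2Space W] :
    IsQuotientCoveringMap (Quotient.mk _ : OrderedConfig d π k → UnorderedConfig d π k)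
      (Equiv.Perm (Fin k)) where
  toIsQuotientMap := isQuotientMap_quotient_mk'
  continuous_const_smul σ := by
    refine Continuous.subtype_mk (Continuous.prodMk ?_ ?_) _
    · exact continuous_pi fun i => (continuous_apply _).comp
        (continuous_fst.comp continuous_subtype_val)
    · exact continuous_pi fun i => (continuous_apply _).comp
        (continuous_snd.comp continuous_subtype_val)
  apply_eq_iff_mem_orbit := Quotient.eq''
  disjoint z := by
    let w : Fin k → W := fun i => z.1.1 i
    have hw : Function.Injective w := fun i j hij => by
      by_contra h
      exact z.2.2 i j h (Subtype.ext hij)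
    obtain ⟨D, hD, hDd⟩ := (Set.finite_range w).t2_separation
    have hc : Continuous fun (z' : OrderedConfig d π k) i => (z'.1.1 i : W) :=
      continuous_pi fun i => continuous_subtype_val.comp ((continuous_apply i).comp
        (continuous_fst.comp continuous_subtype_val))
    refine ⟨(fun (z' : OrderedConfig d π k) i => (z'.1.1 i : W)) ⁻¹'
      Set.pi Set.univ fun i => D (w i), ?_, ?_⟩
    · exact ((isOpen_set_pi Set.finite_univ fun i _ => (hD (w i)).2).preimage hc).mem_nhds
        fun i _ => (hD (w i)).1
    · rintro σ ⟨_, ⟨z', hz', rfl⟩, hz''⟩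
      refine inv_eq_one.1 (Equiv.ext fun i => ?_)
      by_contra h
      exact Set.disjoint_left.1 (hDd ⟨_, rfl⟩ ⟨_, rfl⟩ fun h' => h (hw h')) (hz' (σ⁻¹ i) trivial)
        (hz'' i trivial)

end Covering

/-! ### The wreath product as a group of paths -/

section Wreath

variable {k : ℕ} {Z Q E : Type*} [TopologicalSpace Z] [TopologicalSpace Q] [TopologicalSpace E]
  [MulAction (Equiv.Perm (Fin k)) Z] {j : Z → Fin k → E} {q : Z → Q} {z : Z}
  {σ τ : Equiv.Perm (Fin k)}

namespace WreathPath

/-- The `i`-th coordinate of a path of labels from `σ • z` to `z`. -/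
def coord (hj : Continuous j) (hjσ : ∀ (σ : Equiv.Perm (Fin k)) z i, j (σ • z) i = j z (σ⁻¹ i))
    (γ : Path (σ • z) z) (i : Fin k) : Path (j z (σ⁻¹ i)) (j z i) :=
  (γ.map ((continuous_apply i).comp hj)).cast (hjσ σ z i).symm rfl

/-- The loop in the quotient given by a path from `σ • z` to `z`. -/
def proj (hq : Continuous q) (hqσ : ∀ (σ : Equiv.Perm (Fin k)) z, q (σ • z) = q z)
    (γ : Path (σ • z) z) : Path (q z) (q z) :=
  (γ.map hq).cast (hqσ σ z).symm rfl

/-- The product of paths from `σ • z` to `z` and from `τ • z` to `z`. -/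
noncomputable def mul [ContinuousConstSMul (Equiv.Perm (Fin k)) Z] (γ : Path (σ • z) z)
    (δ : Path (τ • z) z) :
    Path ((σ * τ) • z) z :=
  ((δ.map (continuous_const_smul σ)).cast (mul_smul σ τ z) rfl).trans γ

/-- The coordinates of a path from `σ • z` to `z`, made into loops by means of paths from the
coordinates of `z` to the base point. -/
noncomputable def loops (hj : Continuous j)
    (hjσ : ∀ (σ : Equiv.Perm (Fin k)) z i, j (σ • z) i = j z (σ⁻¹ i))
    {e : E} (β : ∀ i, Path (j z i) e) (γ : Path (σ • z) z) (i : Fin k) : FundamentalGroup E e :=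
  FundamentalGroup.fromPath (((Path.Homotopic.Quotient.mk (β (σ⁻¹ i))).symm.trans
    (Path.Homotopic.Quotient.mk (coord hj hjσ γ i))).trans (Path.Homotopic.Quotient.mk (β i)))

variable (hj : Continuous j) (hjσ : ∀ (σ : Equiv.Perm (Fin k)) z i, j (σ • z) i = j z (σ⁻¹ i))
  (hq : Continuous q) (hqσ : ∀ (σ : Equiv.Perm (Fin k)) z, q (σ • z) = q z)
  {e : E} (β : ∀ i, Path (j z i) e)

theorem conj_trans {x₀ x₁ x₂ : E} (a : Path.Homotopic.Quotient x₀ e)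
    (m : Path.Homotopic.Quotient x₁ e) (b : Path.Homotopic.Quotient x₂ e)
    (u : Path.Homotopic.Quotient x₀ x₁) (v : Path.Homotopic.Quotient x₁ x₂) :
    (a.symm.trans (u.trans v)).trans b =
      ((a.symm.trans u).trans m).trans ((m.symm.trans v).trans b) := by
  simp only [Path.Homotopic.Quotient.trans_assoc]
  rw [← Path.Homotopic.Quotient.trans_assoc m, Path.Homotopic.Quotient.trans_symm,
    Path.Homotopic.Quotient.refl_trans]

theorem conj_injective {x₀ x₁ : E} (a : Path.Homotopic.Quotient x₀ e)
    (b : Path.Homotopic.Quotient x₁ e) :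
    Function.Injective fun u : Path.Homotopic.Quotient x₀ x₁ => (a.symm.trans u).trans b := by
  refine Function.LeftInverse.injective (g := fun w => (a.trans w).trans b.symm) fun u => ?_
  simp only [Path.Homotopic.Quotient.trans_assoc, Path.Homotopic.Quotient.trans_symm,
    Path.Homotopic.Quotient.trans_refl]
  rw [← Path.Homotopic.Quotient.trans_assoc, Path.Homotopic.Quotient.trans_symm,
    Path.Homotopic.Quotient.refl_trans]

theorem proj_mul [ContinuousConstSMul (Equiv.Perm (Fin k)) Z] (γ : Path (σ • z) z)
    (δ : Path (τ • z) z) :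
    proj hq hqσ (mul γ δ) = (proj hq hqσ δ).trans (proj hq hqσ γ) := by
  ext t
  change q (mul γ δ t) = _
  simp only [mul, Path.trans_apply]
  split_ifs
  · exact hqσ _ _
  · rfl

theorem coord_mul [ContinuousConstSMul (Equiv.Perm (Fin k)) Z] (γ : Path (σ • z) z)
    (δ : Path (τ • z) z) (i : Fin k) :
    coord hj hjσ (mul γ δ) i = Path.trans (coord hj hjσ δ (σ⁻¹ i)) (coord hj hjσ γ i) := by
  ext t
  refine Eq.trans ?_ (Path.trans_apply (coord hj hjσ δ (σ⁻¹ i)) (coord hj hjσ γ i) t).symm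
  change j (mul γ δ t) i = _
  simp only [mul, Path.trans_apply]
  split_ifs
  · exact hjσ _ _ _
  · rfl

/-- The shift by `σ⁻¹` is the twist of the semidirect product. The product in `FundamentalGroup`
runs its second factor first, matching the order in `mul`. -/
theorem loops_mul [ContinuousConstSMul (Equiv.Perm (Fin k)) Z] (γ : Path (σ • z) z)
    (δ : Path (τ • z) z) (i : Fin k) :
    loops hj hjσ β (mul γ δ) i = loops hj hjσ β γ i * loops hj hjσ β δ (σ⁻¹ i) := by
  rw [FundamentalGroup.mul_def, loops, coord_mul]
  exact conj_trans (.mk (β ((σ * τ)⁻¹ i))) (.mk (β (σ⁻¹ i))) (.mk (β i))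
    (.mk (coord hj hjσ δ (σ⁻¹ i))) (.mk (coord hj hjσ γ i))

theorem homotopic_of_proj {q : Z → Q} (hq : IsQuotientCoveringMap q (Equiv.Perm (Fin k)))
    {γ δ : Path (σ • z) z}
    (h : (proj hq.continuous (fun σ z => hq.map_smul (e := z) σ) γ).Homotopic
      (proj hq.continuous (fun σ z => hq.map_smul (e := z) σ) δ)) : γ.Homotopic δ :=
  Path.Homotopic.Quotient.exact (hq.isCoveringMap.injective_path_homotopic_map _ _
    (Path.Homotopic.Quotient.eq.2 (h.pathCast (hq.map_smul σ) rfl)))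

/-- The lift of the projected loop that starts at `σ • z` is `γ` itself. This is how a loop
remembers `σ`. -/
theorem monodromy_proj {q : Z → Q} (hq : IsQuotientCoveringMap q (Equiv.Perm (Fin k)))
    (γ : Path (σ • z) z) :
    hq.isCoveringMap.monodromy (.mk (proj hq.continuous (fun σ z => hq.map_smul (e := z) σ) γ))
      ⟨σ • z, hq.map_smul σ⟩ = ⟨z, rfl⟩ :=
  hq.isCoveringMap.monodromy_eq_of_map_eq (Path.Homotopic.Quotient.mk γ) rfl

theorem loops_eq_iff {γ δ : Path (σ • z) z} :
    loops hj hjσ β γ = loops hj hjσ β δ ↔ (γ.map hj).Homotopic (δ.map hj) := by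
  constructor
  · intro h
    have hi : ∀ i, (coord hj hjσ γ i).Homotopic (coord hj hjσ δ i) := fun i =>
      Path.Homotopic.Quotient.exact (conj_injective _ _ (congrFun h i))
    let H := fun i => (hi i).some
    refine ⟨⟨⟨⟨fun s i => H i s, by fun_prop⟩, fun t => ?_, fun t => ?_⟩, fun s t ht => ?_⟩⟩
    · exact funext fun i => (H i).map_zero_left t
    · exact funext fun i => (H i).map_one_left t
    · exact funext fun i => (H i).prop' s t ht
  · intro h
    funext i
    have hi : (coord hj hjσ γ i).Homotopic (coord hj hjσ δ i) :=
      (h.map ⟨_, continuous_apply i⟩).pathCast (hjσ σ z i).symm rfl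
    rw [loops, Path.Homotopic.Quotient.eq.2 hi]
    rfl

/-- Undo the conjugation by `β` in each coordinate; the resulting path of labels is, up to homotopy,
the image of a path in `Z`. -/
theorem exists_loops_eq (hsurj : Function.Surjective fun γ : Path.Homotopic.Quotient (σ • z) z =>
      γ.map ⟨j, hj⟩) (g : Fin k → FundamentalGroup E e) :
    ∃ γ : Path (σ • z) z, loops hj hjσ β γ = g := by
  choose ℓ hℓ using fun i => Path.Homotopic.Quotient.mk_surjective (g i).toPath
  let p : Path (j (σ • z)) (j z) :=
    (Path.pi fun i => ((β (σ⁻¹ i)).trans (ℓ i)).trans (β i).symm).cast (funext (hjσ σ z)) rfl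
  obtain ⟨γ, hγ⟩ := hsurj (.mk p)
  induction γ using Path.Homotopic.Quotient.ind with | _ γ =>
  refine ⟨γ, funext fun i => ?_⟩
  have h : (γ.map hj).Homotopic p := Path.Homotopic.Quotient.exact hγ
  have hi : (coord hj hjσ γ i).Homotopic (((β (σ⁻¹ i)).trans (ℓ i)).trans (β i).symm) :=
    (h.map ⟨_, continuous_apply i⟩).pathCast (hjσ σ z i).symm rfl
  rw [loops, Path.Homotopic.Quotient.eq.2 hi]
  refine Eq.trans ?_ (hℓ i)
  simp only [Path.Homotopic.Quotient.mk_trans, Path.Homotopic.Quotient.mk_symm,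
    Path.Homotopic.Quotient.trans_assoc, Path.Homotopic.Quotient.symm_trans,
    Path.Homotopic.Quotient.trans_refl]
  rw [← Path.Homotopic.Quotient.trans_assoc, Path.Homotopic.Quotient.symm_trans,
    Path.Homotopic.Quotient.refl_trans]

end WreathPath

open WreathPath in
/-- The fundamental group of the quotient of a space of labelled configurations by the symmetric
group, if paths of configurations are up to homotopy the same as paths of tuples of labels. -/
theorem nonempty_fundamentalGroup_mulEquiv_wreath [PathConnectedSpace E] (hj : Continuous j)
    (hjσ : ∀ (σ : Equiv.Perm (Fin k)) z i, j (σ • z) i = j z (σ⁻¹ i))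
    (hq : IsQuotientCoveringMap q (Equiv.Perm (Fin k)))
    (hbij : ∀ z z' : Z, Function.Bijective fun γ : Path.Homotopic.Quotient z z' =>
      γ.map ⟨j, hj⟩) (z : Z) (e : E) :
    Nonempty (FundamentalGroup Q (q z) ≃* SymmetricWreathProduct k (FundamentalGroup E e)) := by
  have := hq.toContinuousConstSMul
  have hqσ : ∀ (σ : Equiv.Perm (Fin k)) z, q (σ • z) = q z := fun σ z => hq.map_smul (e := z) σ
  let β : ∀ i, Path (j z i) e := fun i => (PathConnectedSpace.joined _ _).somePath
  have hinj : ∀ {σ : Equiv.Perm (Fin k)} {γ δ : Path (σ • z) z},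
      loops hj hjσ β γ = loops hj hjσ β δ → γ.Homotopic δ := fun h =>
    Path.Homotopic.Quotient.exact ((hbij _ _).1
      (Path.Homotopic.Quotient.eq.2 ((loops_eq_iff hj hjσ β).1 h)))
  choose L hL using fun a : SymmetricWreathProduct k (FundamentalGroup E e) =>
    exists_loops_eq (σ := a.right) hj hjσ β (hbij _ _).2 a.left
  have hproj : ∀ {σ : Equiv.Perm (Fin k)} {γ δ : Path (σ • z) z}, γ.Homotopic δ →
      (proj hq.continuous hqσ γ).Homotopic (proj hq.continuous hqσ δ) := fun {σ γ δ} h =>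
    (h.map ⟨q, hq.continuous⟩).pathCast (hqσ σ z).symm rfl
  -- The map starts from the wreath product: each pair has a representing path `L a`, unique up to
  -- homotopy. Comparing `loops` of `L (a * b)` and `mul (L a) (L b)` gives multiplicativity.
  let Ψ : SymmetricWreathProduct k (FundamentalGroup E e) →* FundamentalGroup Q (q z) :=
    MonoidHom.mk' (fun a => FundamentalGroup.fromPath (.mk (proj hq.continuous hqσ (L a)))) <| by
      intro a b
      have h : (L (a * b)).Homotopic (mul (L a) (L b)) := hinj <| by
        funext i
        rw [loops_mul, hL, hL, hL]
        rfl
      refine (Path.Homotopic.Quotient.eq.2 (hproj h)).trans ?_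
      rw [proj_mul]
      rfl
  refine ⟨(MulEquiv.ofBijective Ψ ⟨(injective_iff_map_eq_one Ψ).2 fun a ha => ?_,
    fun ℓ => ?_⟩).symm⟩
  · have h1 : (proj hq.continuous hqσ (L a)).Homotopic (proj hq.continuous hqσ (L 1)) :=
      Path.Homotopic.Quotient.exact (ha.trans (map_one Ψ).symm)
    obtain ⟨g, σ⟩ := a
    -- Homotopic loops have the same monodromy, which is injective and sends both `σ • z` and `1 •
    -- z` to `z`. The action is free.
    have hσ : σ = 1 := by
      have h2 := monodromy_proj hq (L ⟨g, σ⟩)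
      rw [Path.Homotopic.Quotient.eq.2 h1] at h2
      have h3 := (hq.isCoveringMap.monodromy_bijective _).1
        (h2.trans (monodromy_proj hq (L 1)).symm)
      exact hq.isCancelSMul.right_cancel _ _ z (congrArg Subtype.val h3)
    subst hσ
    have h2 := homotopic_of_proj hq h1
    have h3 : loops hj hjσ β (L ⟨g, 1⟩) = loops hj hjσ β (L 1) :=
      (loops_eq_iff hj hjσ β).2 (h2.map ⟨j, hj⟩)
    rw [hL, hL] at h3
    exact SemidirectProduct.ext h3 rfl
  · induction ℓ using Path.Homotopic.Quotient.ind with | _ ℓ =>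
    let cov := hq.isCoveringMap
    -- The lift of `ℓ` must end, not start, at `z`, so the reversed loop is lifted from `z` and the
    -- lift is reversed.
    let Γ := cov.liftPath ℓ.symm z ℓ.symm.source
    have hΓ : ∀ t, q (Γ t) = ℓ.symm t := fun t => congrFun (cov.liftPath_lifts ..) t
    have hΓ0 : Γ 0 = z := cov.liftPath_zero ..
    obtain ⟨σ, hσ⟩ := hq.apply_eq_iff_mem_orbit.1 ((hΓ 1).trans ℓ.symm.target)
    let γ : Path (σ • z) z := Path.symm ⟨Γ, hΓ0, hσ.symm⟩
    have h : (L ⟨loops hj hjσ β γ, σ⟩).Homotopic γ := hinj (hL _)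
    refine ⟨⟨loops hj hjσ β γ, σ⟩, (Path.Homotopic.Quotient.eq.2 (hproj h)).trans ?_⟩
    congr 1
    ext t
    exact (hΓ _).trans (by simp)

end Wreath

theorem lemma4p1 {d : ℕ} [NeZero d] (hd : 3 ≤ d)
    {W : Type*} [TopologicalSpace W] [T2Space W] [CompactSpace W] [PathConnectedSpace W]
    [ChartedSpace (EuclideanHalfSpace d) W] [IsManifold (𝓡∂ d) ∞ W]
    (hW : ((𝓡∂ d).boundary W).Nonempty)
    {F : Type*} [TopologicalSpace F] [PathConnectedSpace F]
    {E : Type*} [TopologicalSpace E] (π : E → W) (hπ : IsFibreBundle F π)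
    (k : ℕ) (e : E) (c : UnorderedConfig d π k) :
    Nonempty (FundamentalGroup (UnorderedConfig d π k) c ≃*
      SymmetricWreathProduct k (FundamentalGroup E e)) := by
  have := ChartedSpace.locallyPathConnectedSpace (EuclideanHalfSpace d) W
  have := hπ.pathConnectedSpace
  obtain ⟨z, rfl⟩ := Quotient.exists_rep c
  exact nonempty_fundamentalGroup_mulEquiv_wreath _ (fun _ _ _ => rfl)
    OrderedConfig.isQuotientCoveringMap (OrderedConfig.map_labels_bijective hd hπ) z e
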